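/- Let $\Gamma$ be a group or a monoid. For an $\mathbb F_2$-scheme $X$, a representation of $\Gamma$ on $X$ (of degree $2$) is a monoid homomorphism $\rho:\Gamma\to M_2(\Gamma(X,\mathcal O_X))$. Two representations $\rho,\rho'$ are equivalent, $\rho\sim\rho'$, if there is a $\Gamma(X,\mathcal O_X)$-algebra automorphism $\sigma$ of $M_2(\Gamma(X,\mathcal O_X))$ with $\sigma(\rho(\gamma))=\rho'(\gamma)$ for all $\gamma\in\Gamma$. The representation $\rho$ has unipotent mold over $\mathbb F_2$ if the subsheaf of algebras $\mathcal A=\mathcal O_X[\rho(\Gamma)]\subseteq M_2(\mathcal O_X)$ generated by $\rho(\Gamma)$ is locally free of rank $2$, the quotient $M_2(\mathcal O_X)/\mathcal A$ is locally free, and all local sections of $\mathcal A$ have trace $0$. Let $\mathcal Eq\,\mathcal U_2(\Gamma)_{\mathbb F_2}$ be the sheafification, for the Zariski topology on the category of $\mathbb F_2$-schemes, of the functor $X\mapsto\{\text{representations of }\Gamma\text{ on }X\text{ with unipotent mold over }\mathbb F_2\}/\sim$. For $\alpha\in\Gamma$, an $\mathbb F_2$-algebra $R$ and a character (monoid homomorphism)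 $d:\Gamma\to R$, maps $a,b:\Gamma\to R$ are called $(a,b)$-coefficients with respect to $(d,\alpha)$ if $a(e)=1$, $b(e)=0$, $a(\alpha)=0$, $b(\alpha)=1$ and, for all $\gamma,\delta\in\Gamma$, $$a(\gamma\delta)=a(\gamma)a(\delta)+b(\gamma)b(\delta)d(\alpha),\quad b(\gamma\delta)=a(\gamma)b(\delta)+b(\gamma)a(\delta),\quad a(\gamma)^2+b(\gamma)^2d(\alpha)=d(\gamma).$$ Let $A_\alpha$ be the $\mathbb F_2$-algebra generated by symbols $d(\gamma),a_\alpha(\gamma),b_\alpha(\gamma)$ ($\gamma\in\Gamma$) subject to the relations saying that $d$ is a character and that $a_\alpha,b_\alpha$ are $(a,b)$-coefficients with respect to $(d,\alpha)$. **Theorem.** (i) For each $\alpha\in\Gamma$ the affine scheme $\operatorname{Spec}A_\alpha$ parametrizes $(a,b)$-coefficients: for every $\mathbb F_2$-scheme $X$, pulling back the universal ones gives a bijection from the set of $\mathbb F_2$-morphisms $X\to\operatorname{Spec}A_\alpha$ to the set of triples $(d,a,b)$, where $d:\Gamma\to\Gamma(X,\mathcal O_X)$ is a character and $a,b$ are $(a,b)$-coefficients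 with respect to $(d,\alpha)$. (ii) The schemes $\operatorname{Spec}A_\alpha$ $(\alpha\in\Gamma)$ can be glued to an $\mathbb F_2$-scheme $\mathrm{Ch}_2(\Gamma)_{u/\mathbb F_2}$ along the open subschemes $U_{\alpha,\beta}=\{b_\alpha(\beta)\neq0\}\subseteq\operatorname{Spec}A_\alpha$, the transition $U_{\alpha,\beta}\to\operatorname{Spec}A_\beta$ (with image $U_{\beta,\alpha}$) being given on functions by $d(\gamma)\mapsto d(\gamma)$, $a_\beta(\gamma)\mapsto a_\alpha(\gamma)+a_\alpha(\beta)b_\alpha(\beta)^{-1}b_\alpha(\gamma)$, $b_\beta(\gamma)\mapsto b_\alpha(\gamma)b_\alpha(\beta)^{-1}$. (iii) $\mathrm{Ch}_2(\Gamma)_{u/\mathbb F_2}$ represents $\mathcal Eq\,\mathcal U_2(\Gamma)_{\mathbb F_2}$, that is, it is a fine moduli scheme for this functor. The identification can be chosen such that, whenever $\rho$ is a representation with unipotent mold over $\mathbb F_2$ on $X$, $\alpha\in\Gamma$, and $a,b$ are $(a,b)$-coefficients with respect to $(\det\rho,\alpha)$ with $\rho(\gamma)=a(\gamma)I_2+b(\gamma)\rho(\alpha)$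 for all $\gamma\in\Gamma$, the class of $\rho$ corresponds to the composite $X\to\operatorname{Spec}A_\alpha\to\mathrm{Ch}_2(\Gamma)_{u/\mathbb F_2}$ whose first morphism is given by $(\det\rho,a,b)$. (iv) $\mathrm{Ch}_2(\Gamma)_{u/\mathbb F_2}$ is separated over $\mathbb F_2$; if $\Gamma$ is a finitely generated group or monoid, it is of finite type over $\mathbb F_2$. -/

import Mathlib

open CategoryTheory AlgebraicGeometry Opposite TopologicalSpace

universe u

namespace UnipotentModuli

/-! ### Matrices, molds and representations on schemes -/

/-- The ring of `2 × 2` matrices. -/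
abbrev M2 (R : Type*) := Matrix (Fin 2) (Fin 2) R

/-- Restriction of functions along an inclusion of open subsets. -/
noncomputable abbrev res {X : Scheme.{u}} {U V : X.Opens} (h : V ≤ U) : Γ(X, U) →+* Γ(X, V) :=
  (X.presheaf.map (homOfLE h).op).hom

/-- Restriction of matrices of functions along an inclusion of open subsets. -/
noncomputable abbrev resM {X : Scheme.{u}} {U V : X.Opens} (h : V ≤ U) :
    M2 Γ(X, U) →+* M2 Γ(X, V) :=
  (res h).mapMatrix

/-- A subsheaf `𝒜 ⊆ M₂(𝒪_X)` of `𝒪_X`-algebras on a scheme `X`. -/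
structure SubsheafM2 (X : Scheme.{u}) where
  /-- The sections over an open subset. -/
  sections (U : X.Opens) : Subalgebra Γ(X, U) (M2 Γ(X, U))
  restrict {U V : X.Opens} (h : V ≤ U) {M : M2 Γ(X, U)} (hM : M ∈ sections U) :
    resM h M ∈ sections V
  locality {U : X.Opens} (M : M2 Γ(X, U))
    (hM : ∀ x ∈ U, ∃ (V : X.Opens) (h : V ≤ U), x ∈ V ∧ resM h M ∈ sections V) :
    M ∈ sections U

namespace SubsheafM2

variable {X : Scheme.{u}} (A : SubsheafM2 X)

/-- `𝒜` is a mold: the quotient sheaf `M₂(𝒪_X)/𝒜` is locally free (of finite rank).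
Near each point there are matrices `e₁, …, e_r` whose classes form a basis of the quotient over
each smaller open subset. -/
def IsMold : Prop :=
  ∀ x : X, ∃ (U : X.Opens) (_ : x ∈ U) (r : ℕ) (e : Fin r → M2 Γ(X, U)),
    ∀ (V : X.Opens) (h : V ≤ U) (M : M2 Γ(X, V)),
      ∃! c : Fin r → Γ(X, V), M - ∑ i, c i • resM h (e i) ∈ A.sections V

/-- `𝒜` is locally free of rank `m` as an `𝒪_X`-module. -/
def HasRank (m : ℕ) : Prop :=
  ∀ x : X, ∃ (U : X.Opens) (_ : x ∈ U) (e : Fin m → M2 Γ(X, U)),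
    (∀ i, e i ∈ A.sections U) ∧
    ∀ (V : X.Opens) (h : V ≤ U), ∀ M ∈ A.sections V,
      ∃! c : Fin m → Γ(X, V), M = ∑ i, c i • resM h (e i)

/-- A rank `2` mold is unipotent over `𝔽₂` if all its local sections have trace `0`
(used on schemes over `𝔽₂`). -/
def IsUnipotentF2 : Prop :=
  A.IsMold ∧ A.HasRank 2 ∧ ∀ (U : X.Opens), ∀ M ∈ A.sections U, M.trace = 0

end SubsheafM2

/-- A `2`-dimensional representation of the monoid `G` on the scheme `X`. -/
abbrev Rep (G : Type u) [Monoid G] (X : Scheme.{u}) := G →* M2 Γ(X, ⊤)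

section Rep

variable {G : Type u} [Monoid G]

/-- The pullback of a representation along a morphism of schemes. -/
noncomputable def Rep.pullback {X Y : Scheme.{u}} (f : Y ⟶ X) (ρ : Rep G X) : Rep G Y :=
  (f.appTop.hom.mapMatrix : M2 Γ(X, ⊤) →+* M2 Γ(Y, ⊤)).toMonoidHom.comp ρ

lemma Rep.pullback_apply {X Y : Scheme.{u}} (f : Y ⟶ X) (ρ : Rep G X) (g : G) :
    ρ.pullback f g = (f.appTop.hom.mapMatrix : M2 Γ(X, ⊤) →+* M2 Γ(Y, ⊤)) (ρ g) := rfl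

lemma res_res {X : Scheme.{u}} {U V W : X.Opens} (h : V ≤ U) (h' : W ≤ V) (a : Γ(X, U)) :
    res h' (res h a) = res (h'.trans h) a := by
  have := X.presheaf.map_comp (homOfLE h).op (homOfLE h').op
  exact (congrArg (fun φ => φ.hom a) this).symm

lemma resM_resM {X : Scheme.{u}} {U V W : X.Opens} (h : V ≤ U) (h' : W ≤ V) (M : M2 Γ(X, U)) :
    resM h' (resM h M) = resM (h'.trans h) M := by
  ext i j
  exact res_res h h' (M i j)

lemma res_self {X : Scheme.{u}} {U : X.Opens} (h : U ≤ U) (a : Γ(X, U)) : res h a = a := by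
  have := X.presheaf.map_id (op U)
  exact congrArg (fun φ => φ.hom a) this

lemma eq_of_locally {X : Scheme.{u}} {U : X.Opens} (a b : Γ(X, U))
    (H : ∀ x ∈ U, ∃ (V : X.Opens) (h : V ≤ U), x ∈ V ∧ res h a = res h b) : a = b := by
  choose V h hx hab using fun x : U => H x.1 x.2
  exact X.sheaf.eq_of_locally_eq' V U (fun x => homOfLE (h x))
    (fun x hxU => Opens.mem_iSup.2 ⟨⟨x, hxU⟩, hx _⟩) a b hab

/-- Matrices in an adjoined subalgebra are preserved by a change of rings. -/
lemma map_mem_adjoin {R S ι : Type*} [CommRing R] [CommRing S] (φ : R →+* S) (σ : ι → M2 R)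
    {M : M2 R} (hM : M ∈ Algebra.adjoin R (Set.range σ)) :
    φ.mapMatrix M ∈ Algebra.adjoin S (Set.range fun i => φ.mapMatrix (σ i)) := by
  induction hM using Algebra.adjoin_induction with
  | mem x hx =>
    obtain ⟨i, rfl⟩ := hx
    exact Algebra.subset_adjoin ⟨i, rfl⟩
  | algebraMap r =>
    have : φ.mapMatrix (algebraMap R (M2 R) r) = algebraMap S (M2 S) (φ r) := by
      ext i j
      simp [Matrix.algebraMap_matrix_apply, apply_ite φ]
    rw [this]
    exact Subalgebra.algebraMap_mem _ _
  | add x y _ _ hx hy => rw [map_add]; exact add_mem hx hy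
  | mul x y _ _ hx hy => rw [map_mul]; exact mul_mem hx hy

/-- The subsheaf of algebras `𝒪_X[ρ(G)]` generated by the image of a representation: its sections
are the matrices that lie locally in the algebra generated by the matrices `ρ(g)`. -/
noncomputable def Rep.generated {X : Scheme.{u}} (ρ : Rep G X) : SubsheafM2 X where
  sections U :=
    { carrier := {M | ∀ x ∈ U, ∃ (V : X.Opens) (h : V ≤ U), x ∈ V ∧
        resM h M ∈ Algebra.adjoin Γ(X, V) (Set.range fun g => resM (le_top : V ≤ ⊤) (ρ g))}
      mul_mem' := by
        intro M N hM hN x hx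
        obtain ⟨V, h, hxV, hV⟩ := hM x hx
        obtain ⟨W, h', hxW, hW⟩ := hN x hx
        refine ⟨V ⊓ W, inf_le_left.trans h, ⟨hxV, hxW⟩, ?_⟩
        have h1 := map_mem_adjoin (res (inf_le_left : V ⊓ W ≤ V)) _ hV
        have h2 := map_mem_adjoin (res (inf_le_right : V ⊓ W ≤ W)) _ hW
        simp only [resM_resM] at h1 h2
        rw [map_mul]
        exact mul_mem h1 h2
      add_mem' := by
        intro M N hM hN x hx
        obtain ⟨V, h, hxV, hV⟩ := hM x hx
        obtain ⟨W, h', hxW, hW⟩ := hN x hx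
        refine ⟨V ⊓ W, inf_le_left.trans h, ⟨hxV, hxW⟩, ?_⟩
        have h1 := map_mem_adjoin (res (inf_le_left : V ⊓ W ≤ V)) _ hV
        have h2 := map_mem_adjoin (res (inf_le_right : V ⊓ W ≤ W)) _ hW
        simp only [resM_resM] at h1 h2
        rw [map_add]
        exact add_mem h1 h2
      algebraMap_mem' := by
        intro r x hx
        refine ⟨U, le_rfl, hx, ?_⟩
        have : resM le_rfl (algebraMap Γ(X, U) (M2 Γ(X, U)) r) = algebraMap _ _ r := by
          ext i j
          exact res_self _ _
        rw [this]
        exact Subalgebra.algebraMap_mem _ _ }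
  restrict := by
    intro U V h M hM x hx
    obtain ⟨W, h', hxW, hW⟩ := hM x (h hx)
    refine ⟨W ⊓ V, inf_le_right, ⟨hxW, hx⟩, ?_⟩
    have h1 := map_mem_adjoin (res (inf_le_left : W ⊓ V ≤ W)) _ hW
    simp only [resM_resM] at h1 ⊢
    exact h1
  locality := by
    intro U M hM x hx
    obtain ⟨V, h, hxV, hV⟩ := hM x hx
    obtain ⟨W, h', hxW, hW⟩ := hV x hxV
    refine ⟨W, h'.trans h, hxW, ?_⟩
    rwa [resM_resM] at hW

/-- `ρ` is a representation with unipotent mold over `𝔽₂` (used on schemes over `𝔽₂`). -/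
def Rep.IsUnipotentF2 {X : Scheme.{u}} (ρ : Rep G X) : Prop :=
  ρ.generated.IsUnipotentF2

/-- Equivalence of representations: they differ by an automorphism of the `Γ(X, 𝒪_X)`-algebra
`M₂(Γ(X, 𝒪_X))`. -/
def Rep.Equivalent {X : Scheme.{u}} (ρ ρ' : Rep G X) : Prop :=
  ∃ σ : M2 Γ(X, ⊤) ≃ₐ[Γ(X, ⊤)] M2 Γ(X, ⊤), ∀ g, σ (ρ g) = ρ' g

end Rep

/-! ### Stability of unipotent molds under base change -/

section BaseChange

/-- Auxiliary: a basis `Z ∪ e` of `M₂(R)` (with dual basis `Q`) whose part `Z` spans the algebra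
generated by the matrices `σ i`, all of trace `0`. -/
structure Frame {R ι : Type*} [CommRing R] (σ : ι → M2 R) (r : ℕ)
    (Z : Fin 2 → M2 R) (e : Fin r → M2 R) : Prop where
  dual : ∃ Q : Fin 2 ⊕ Fin r → M2 R,
    (∀ k l, ∑ i, ∑ j, Q k i j * (Sum.elim Z e l) i j = if k = l then 1 else 0) ∧
    ∀ i j i' j', ∑ k, Q k i j * (Sum.elim Z e k) i' j' = if i = i' ∧ j = j' then 1 else 0
  mem : ∀ k, Z k ∈ Algebra.adjoin R (Set.range σ)
  gen : ∀ i, ∃ c : Fin 2 → R, σ i = ∑ k, c k • Z k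
  one : ∃ c : Fin 2 → R, (1 : M2 R) = ∑ k, c k • Z k
  mul : ∀ k l, ∃ c : Fin 2 → R, Z k * Z l = ∑ m, c m • Z m
  trace : ∀ k, (Z k).trace = 0

variable {R S ι : Type*} [CommRing R] [CommRing S]

lemma mapMatrix_sum_smul (φ : R →+* S) {n : ℕ} (c : Fin n → R) (Z : Fin n → M2 R) :
    φ.mapMatrix (∑ k, c k • Z k) = ∑ k, φ (c k) • φ.mapMatrix (Z k) := by
  rw [map_sum]
  refine Finset.sum_congr rfl fun k _ => ?_
  ext i j
  simp

lemma trace_mapMatrix (φ : R →+* S) (M : M2 R) : (φ.mapMatrix M).trace = φ M.trace := by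
  simp [Matrix.trace]

lemma Frame.map (φ : R →+* S) {σ : ι → M2 R} {r : ℕ} {Z : Fin 2 → M2 R} {e : Fin r → M2 R}
    (F : Frame σ r Z e) :
    Frame (fun i => φ.mapMatrix (σ i)) r (fun k => φ.mapMatrix (Z k))
      (fun k => φ.mapMatrix (e k)) where
  dual := by
    obtain ⟨Q, h1, h2⟩ := F.dual
    have key : ∀ k i j, (Sum.elim (fun k => φ.mapMatrix (Z k)) (fun k => φ.mapMatrix (e k)) k :
        M2 S) i j = φ ((Sum.elim Z e k) i j) := by
      rintro (k | k) i j <;> rfl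
    refine ⟨fun k => φ.mapMatrix (Q k), fun k l => ?_, fun i j i' j' => ?_⟩
    · have := congrArg φ (h1 k l)
      rw [apply_ite φ, map_one, map_zero] at this
      rw [← this, map_sum]
      refine Finset.sum_congr rfl fun i _ => ?_
      rw [map_sum]
      refine Finset.sum_congr rfl fun j _ => ?_
      rw [key, map_mul]; rfl
    · have := congrArg φ (h2 i j i' j')
      rw [apply_ite φ, map_one, map_zero, map_sum] at this
      rw [← this]
      refine Finset.sum_congr rfl fun k _ => ?_
      rw [key, map_mul]; rfl
  mem k := map_mem_adjoin φ σ (F.mem k)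
  gen i := by
    obtain ⟨c, hc⟩ := F.gen i
    exact ⟨fun k => φ (c k), by rw [hc, mapMatrix_sum_smul]⟩
  one := by
    obtain ⟨c, hc⟩ := F.one
    exact ⟨fun k => φ (c k), by rw [← mapMatrix_sum_smul, ← hc, map_one]⟩
  mul k l := by
    obtain ⟨c, hc⟩ := F.mul k l
    exact ⟨fun k => φ (c k), by rw [← map_mul, hc, mapMatrix_sum_smul]⟩
  trace k := by rw [trace_mapMatrix, F.trace, map_zero]

lemma Frame.coord {σ : ι → M2 R} {r : ℕ} {Z : Fin 2 → M2 R} {e : Fin r → M2 R}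
    (F : Frame σ r Z e) : ∃ q : Fin 2 ⊕ Fin r → M2 R →ₗ[R] R,
      (∀ k l, q k (Sum.elim Z e l) = if k = l then 1 else 0) ∧
      ∀ M, M = ∑ k, q (Sum.inl k) M • Z k + ∑ k, q (Sum.inr k) M • e k := by
  obtain ⟨Q, h1, h2⟩ := F.dual
  refine ⟨fun k => ∑ i, ∑ j, Q k i j • Matrix.entryLinearMap R R i j, fun k l => ?_, fun M => ?_⟩
  · rw [← h1 k l]; simp [Matrix.entryLinearMap_apply]
  · have hM : ∀ i' j', M i' j' = ∑ i, ∑ j, ∑ k, Q k i j * M i j * (Sum.elim Z e k) i' j' := by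
      intro i' j'
      have : ∀ i j, ∑ k, Q k i j * M i j * (Sum.elim Z e k) i' j'
          = M i j * if i = i' ∧ j = j' then 1 else 0 := by
        intro i j
        rw [← h2 i j i' j', Finset.mul_sum]
        exact Finset.sum_congr rfl fun k _ => by ring
      simp only [this]
      fin_cases i' <;> fin_cases j' <;> simp [Fin.sum_univ_two]
    ext i' j'
    rw [hM i' j']
    simp only [Matrix.add_apply, Matrix.sum_apply, Matrix.smul_apply, smul_eq_mul,
      LinearMap.sum_apply, LinearMap.smul_apply, Matrix.entryLinearMap_apply]
    simp only [Fin.sum_univ_two, Fintype.sum_sum_type, Sum.elim_inl, Sum.elim_inr, add_mul,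
      Finset.sum_add_distrib]
    ring

lemma Frame.mem_adjoin_iff {σ : ι → M2 R} {r : ℕ} {Z : Fin 2 → M2 R} {e : Fin r → M2 R}
    (F : Frame σ r Z e) (M : M2 R) :
    M ∈ Algebra.adjoin R (Set.range σ) ↔ ∃ c : Fin 2 → R, M = ∑ k, c k • Z k := by
  constructor
  · intro hM
    have hspan : ∀ M, M ∈ Submodule.span R (Set.range Z) ↔ ∃ c : Fin 2 → R, M = ∑ k, c k • Z k := by
      intro M
      rw [Submodule.mem_span_range_iff_exists_fun]
      exact exists_congr fun c => eq_comm
    rw [← hspan]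
    induction hM using Algebra.adjoin_induction with
    | mem x hx =>
      obtain ⟨i, rfl⟩ := hx
      exact (hspan _).2 (F.gen i)
    | algebraMap s =>
      rw [Algebra.algebraMap_eq_smul_one]
      exact Submodule.smul_mem _ _ ((hspan _).2 F.one)
    | add x y _ _ hx hy => exact add_mem hx hy
    | mul x y hx' hy' hx hy =>
      clear hx' hy'
      induction hx using Submodule.span_induction with
      | mem x hx =>
        obtain ⟨k, rfl⟩ := hx
        induction hy using Submodule.span_induction with
        | mem y hy =>
          obtain ⟨l, rfl⟩ := hy
          exact (hspan _).2 (F.mul k l)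
        | zero => rw [mul_zero]; exact zero_mem _
        | add x y _ _ hx hy => rw [mul_add]; exact add_mem hx hy
        | smul a x _ hx => rw [mul_smul_comm]; exact Submodule.smul_mem _ _ hx
      | zero => rw [zero_mul]; exact zero_mem _
      | add x y _ _ hx hy => rw [add_mul]; exact add_mem hx hy
      | smul a x _ hx => rw [smul_mul_assoc]; exact Submodule.smul_mem _ _ hx
  · rintro ⟨c, rfl⟩
    exact Subalgebra.sum_mem _ fun k _ => Subalgebra.smul_mem _ (F.mem k) _

lemma Frame.unique {σ : ι → M2 R} {r : ℕ} {Z : Fin 2 → M2 R} {e : Fin r → M2 R}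
    (F : Frame σ r Z e) {c c' : Fin 2 → R} {d d' : Fin r → R}
    (h : ∑ k, c k • Z k + ∑ k, d k • e k = ∑ k, c' k • Z k + ∑ k, d' k • e k) :
    c = c' ∧ d = d' := by
  obtain ⟨q, hq, -⟩ := F.coord
  have hZ : ∀ k l, q k (Z l) = if k = Sum.inl l then 1 else 0 := fun k l => hq k (Sum.inl l)
  have he : ∀ k l, q k (e l) = if k = Sum.inr l then 1 else 0 := fun k l => hq k (Sum.inr l)
  constructor
  · funext m
    simpa [hZ, he, Fin.sum_univ_two, -Fin.sum_univ_two] using congrArg (q (Sum.inl m)) h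
  · funext m
    simpa [hZ, he] using congrArg (q (Sum.inr m)) h

variable {G : Type u} [Monoid G]

/-- Auxiliary: frames exist locally on the scheme. -/
def Rep.HasFrames {X : Scheme.{u}} (ρ : Rep G X) : Prop :=
  ∀ x : X, ∃ (U : X.Opens) (_ : x ∈ U) (r : ℕ) (Z : Fin 2 → M2 Γ(X, U)) (e : Fin r → M2 Γ(X, U)),
    Frame (fun g => resM (le_top : U ≤ ⊤) (ρ g)) r Z e

lemma mem_generated_of_mem_adjoin {X : Scheme.{u}} (ρ : Rep G X) {U : X.Opens} {M : M2 Γ(X, U)}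
    (hM : M ∈ Algebra.adjoin Γ(X, U) (Set.range fun g => resM (le_top : U ≤ ⊤) (ρ g))) :
    M ∈ ρ.generated.sections U := by
  intro x hx
  refine ⟨U, le_rfl, hx, ?_⟩
  have : resM le_rfl M = M := by
    ext i j
    exact res_self _ _
  rwa [this]

lemma Frame.res {X : Scheme.{u}} (ρ : Rep G X) {U V : X.Opens} (h : V ≤ U) {r : ℕ}
    {Z : Fin 2 → M2 Γ(X, U)} {e : Fin r → M2 Γ(X, U)}
    (F : Frame (fun g => resM (le_top : U ≤ ⊤) (ρ g)) r Z e) :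
    Frame (fun g => resM (le_top : V ≤ ⊤) (ρ g)) r (fun k => resM h (Z k))
      (fun k => resM h (e k)) := by
  have := F.map (UnipotentModuli.res h)
  simpa only [resM_resM] using this

lemma Frame.mem_generated_iff {X : Scheme.{u}} (ρ : Rep G X) {U : X.Opens} {r : ℕ}
    {Z : Fin 2 → M2 Γ(X, U)} {e : Fin r → M2 Γ(X, U)}
    (F : Frame (fun g => resM (le_top : U ≤ ⊤) (ρ g)) r Z e) (M : M2 Γ(X, U)) :
    M ∈ ρ.generated.sections U ↔ ∃ c : Fin 2 → Γ(X, U), M = ∑ k, c k • Z k := by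
  rw [← F.mem_adjoin_iff]
  refine ⟨fun hM => ?_, mem_generated_of_mem_adjoin ρ⟩
  obtain ⟨q, hq, hM'⟩ := F.coord
  rw [F.mem_adjoin_iff]
  refine ⟨fun k => q (Sum.inl k) M, ?_⟩
  have h0 : ∀ k, q (Sum.inr k) M = 0 := by
    intro k
    refine eq_of_locally _ _ fun x hx => ?_
    obtain ⟨V, h, hxV, hV⟩ := hM x hx
    refine ⟨V, h, hxV, ?_⟩
    rw [(F.res ρ h).mem_adjoin_iff] at hV
    obtain ⟨c, hc⟩ := hV
    have h1 := hM' M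
    apply_fun resM h at h1
    rw [map_add, mapMatrix_sum_smul, mapMatrix_sum_smul, hc] at h1
    have h2 := (F.res ρ h).unique (c := c) (d := 0) (d' := fun k => UnipotentModuli.res h
      (q (Sum.inr k) M)) (c' := fun k => UnipotentModuli.res h (q (Sum.inl k) M))
      (by simpa using h1)
    rw [map_zero]
    exact (congrFun h2.2 k).symm
  conv_lhs => rw [hM' M]
  simp [h0]

lemma Rep.HasFrames.isUnipotentF2 {X : Scheme.{u}} {ρ : Rep G X} (H : ρ.HasFrames) :
    ρ.IsUnipotentF2 := by
  refine ⟨fun x => ?_, fun x => ?_, fun U M hM => ?_⟩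
  · obtain ⟨U, hx, r, Z, e, F⟩ := H x
    refine ⟨U, hx, r, e, fun V h M => ?_⟩
    have F' := F.res ρ h
    obtain ⟨q, hq, hM⟩ := F'.coord
    refine ⟨fun k => q (Sum.inr k) M, ?_, fun c hc => ?_⟩
    · exact (F'.mem_generated_iff ρ _).2 ⟨fun k => q (Sum.inl k) M, by
        rw [sub_eq_iff_eq_add]; exact hM M⟩
    · obtain ⟨c', hc'⟩ := (F'.mem_generated_iff ρ _).1 hc
      rw [sub_eq_iff_eq_add] at hc'
      exact (F'.unique (hc'.symm.trans (hM M))).2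
  · obtain ⟨U, hx, r, Z, e, F⟩ := H x
    refine ⟨U, hx, Z, fun k => mem_generated_of_mem_adjoin ρ (F.mem k), fun V h M hM => ?_⟩
    have F' := F.res ρ h
    obtain ⟨c, hc⟩ := (F'.mem_generated_iff ρ _).1 hM
    refine ⟨c, hc, fun c' hc' => ?_⟩
    exact (F'.unique (d := 0) (d' := 0) (by simpa using hc'.symm.trans hc)).1
  · refine eq_of_locally _ _ fun x hxU => ?_
    obtain ⟨V, hx, r, Z, e, F⟩ := H x
    refine ⟨U ⊓ V, inf_le_left, ⟨hxU, hx⟩, ?_⟩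
    have F' := F.res ρ (inf_le_right : U ⊓ V ≤ V)
    obtain ⟨c, hc⟩ := (F'.mem_generated_iff ρ _).1
      (ρ.generated.restrict (inf_le_left : U ⊓ V ≤ U) hM)
    rw [map_zero, ← trace_mapMatrix]
    rw [show (UnipotentModuli.res (inf_le_left : U ⊓ V ≤ U)).mapMatrix M = _ from hc]
    rw [Matrix.trace_sum]
    exact Finset.sum_eq_zero fun k _ => by rw [Matrix.trace_smul, F'.trace, smul_zero]

lemma frame_of_bases {ι : Type*} {R : Type*} [CommRing R] {σ : ι → M2 R} {r : ℕ}
    {Z : Fin 2 → M2 R} {e : Fin r → M2 R} (A : Subalgebra R (M2 R))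
    (hσ : ∀ i, σ i ∈ A) (hZA : ∀ k, Z k ∈ A)
    (hZ : ∀ M ∈ A, ∃! c : Fin 2 → R, M = ∑ k, c k • Z k)
    (he : ∀ M, ∃! c : Fin r → R, M - ∑ k, c k • e k ∈ A)
    (hadj : ∀ k, Z k ∈ Algebra.adjoin R (Set.range σ)) (htr : ∀ M ∈ A, M.trace = 0) :
    Frame σ r Z e where
  dual := by
    have hex : ∀ M, ∃ c : Fin 2 ⊕ Fin r → R, M = ∑ k, c k • Sum.elim Z e k := by
      intro M
      obtain ⟨d, hd, -⟩ := he M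
      obtain ⟨c, hc, -⟩ := hZ _ hd
      refine ⟨Sum.elim c d, ?_⟩
      simp only [Fintype.sum_sum_type, Sum.elim_inl, Sum.elim_inr]
      rw [sub_eq_iff_eq_add] at hc
      exact hc
    have huniq : ∀ c : Fin 2 ⊕ Fin r → R, ∀ c' : Fin 2 ⊕ Fin r → R,
        ∑ k, c k • Sum.elim Z e k = ∑ k, c' k • Sum.elim Z e k → c = c' := by
      intro c c' h
      simp only [Fintype.sum_sum_type, Sum.elim_inl, Sum.elim_inr] at h
      have hA : ∀ c : Fin 2 → R, ∑ k, c k • Z k ∈ A := fun c =>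
        Subalgebra.sum_mem _ fun k _ => Subalgebra.smul_mem _ (hZA k) _
      obtain ⟨d, hd, hu⟩ := he (∑ k, c (Sum.inl k) • Z k + ∑ k, c (Sum.inr k) • e k)
      have h1 := hu (fun k => c (Sum.inr k)) (by beta_reduce; rw [add_sub_cancel_right]; exact hA _)
      have h2 := hu (fun k => c' (Sum.inr k)) (by beta_reduce; rw [h, add_sub_cancel_right]; exact hA _)
      have h3 : ∀ k, c (Sum.inr k) = c' (Sum.inr k) := fun k => congrFun (h1.trans h2.symm) k
      simp only [h3, add_left_inj] at h
      obtain ⟨d, hd, hu⟩ := hZ _ (hA fun k => c (Sum.inl k))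
      have h4 := (hu (fun k => c (Sum.inl k)) rfl).trans (hu (fun k => c' (Sum.inl k)) h).symm
      funext k
      rcases k with k | k
      · exact congrFun h4 k
      · exact h3 k
    choose q hq using hex
    refine ⟨fun k => Matrix.of fun i j => q (Matrix.single i j 1) k, fun k l => ?_,
      fun i j i' j' => ?_⟩
    · have : (fun k => ∑ i, ∑ j, q (Matrix.single i j 1) k * (Sum.elim Z e l) i j)
          = fun k => if k = l then 1 else 0 := by
        apply huniq
        have h1 : ∑ k, (if k = l then (1 : R) else 0) • Sum.elim Z e k = Sum.elim Z e l := by simp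
        rw [h1]
        have h2 : Sum.elim Z e l = ∑ i, ∑ j, (Sum.elim Z e l) i j • Matrix.single i j (1 : R) := by
          conv_lhs => rw [Matrix.matrix_eq_sum_single (Sum.elim Z e l)]
          simp
        conv_rhs => rw [h2]
        simp only [Finset.sum_smul]
        rw [Finset.sum_comm]
        refine Finset.sum_congr rfl fun i _ => ?_
        rw [Finset.sum_comm]
        refine Finset.sum_congr rfl fun j _ => ?_
        conv_rhs => rw [hq (Matrix.single i j 1)]
        rw [Finset.smul_sum]
        refine Finset.sum_congr rfl fun m _ => ?_
        rw [smul_smul, mul_comm]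
      exact congrFun this k
    · have := congrFun (congrFun (hq (Matrix.single i j 1)) i') j'
      rw [Matrix.sum_apply] at this
      simp only [Matrix.single_apply, Matrix.smul_apply, smul_eq_mul] at this
      exact this.symm
  mem := hadj
  gen i := (hZ _ (hσ i)).exists
  one := (hZ _ (one_mem A)).exists
  mul k l := (hZ _ (mul_mem (hZA k) (hZA l))).exists
  trace k := htr _ (hZA k)

lemma Rep.IsUnipotentF2.hasFrames {X : Scheme.{u}} {ρ : Rep G X} (H : ρ.IsUnipotentF2) :
    ρ.HasFrames := by
  intro x
  obtain ⟨hm, hr, ht⟩ := H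
  obtain ⟨U₁, hx₁, r, e, he⟩ := hm x
  obtain ⟨U₂, hx₂, Z, hZA, hZ⟩ := hr x
  choose V hV hxV hadj using fun k => hZA k x hx₂
  let W : X.Opens := (U₁ ⊓ U₂) ⊓ (V 0 ⊓ V 1)
  have hW₁ : W ≤ U₁ := inf_le_left.trans inf_le_left
  have hW₂ : W ≤ U₂ := inf_le_left.trans inf_le_right
  have hWV : ∀ k, W ≤ V k := by
    intro k
    fin_cases k
    · exact inf_le_right.trans inf_le_left
    · exact inf_le_right.trans inf_le_right
  refine ⟨W, ⟨⟨hx₁, hx₂⟩, hxV 0, hxV 1⟩, r, fun k => resM hW₂ (Z k), fun k => resM hW₁ (e k), ?_⟩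
  refine frame_of_bases (ρ.generated.sections W) (fun g => ?_) (fun k => ?_) (hZ W hW₂)
    (he W hW₁) (fun k => ?_) (ht W)
  · exact mem_generated_of_mem_adjoin ρ (Algebra.subset_adjoin ⟨g, rfl⟩)
  · exact ρ.generated.restrict hW₂ (hZA k)
  · have := map_mem_adjoin (UnipotentModuli.res (hWV k)) _ (hadj k)
    simpa only [resM_resM] using this

lemma Rep.IsUnipotentF2.pullback {X Y : Scheme.{u}} (f : Y ⟶ X) {ρ : Rep G X}
    (H : ρ.IsUnipotentF2) : (ρ.pullback f).IsUnipotentF2 := by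
  refine Rep.HasFrames.isUnipotentF2 fun y => ?_
  obtain ⟨U, hx, r, Z, e, F⟩ := H.hasFrames (f y)
  refine ⟨f ⁻¹ᵁ U, hx, r, fun k => (f.app U).hom.mapMatrix (Z k),
    fun k => (f.app U).hom.mapMatrix (e k), ?_⟩
  have := F.map (f.app U).hom
  convert this using 2 with g
  ext i j
  have := f.naturality (homOfLE (le_top : U ≤ ⊤)).op
  exact congrArg (fun φ => φ.hom (ρ g i j)) this.symm

/-- Equivalent representations have equivalent pullbacks. -/
lemma Rep.Equivalent.pullback {X Y : Scheme.{u}} (f : Y ⟶ X) {ρ ρ' : Rep G X}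
    (H : ρ.Equivalent ρ') : (ρ.pullback f).Equivalent (ρ'.pullback f) := by
  obtain ⟨σ, hσ⟩ := H
  let _ : Algebra Γ(X, ⊤) Γ(Y, ⊤) := f.appTop.hom.toAlgebra
  let E := matrixEquivTensor (Fin 2) Γ(X, ⊤) Γ(Y, ⊤)
  have hE : ∀ M : M2 Γ(X, ⊤), E.symm (1 ⊗ₜ M) = f.appTop.hom.mapMatrix M := by
    intro M
    rw [matrixEquivTensor_apply_symm, one_smul]
    rfl
  let τ : M2 Γ(Y, ⊤) ≃ₐ[Γ(X, ⊤)] M2 Γ(Y, ⊤) :=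
    (E.trans (Algebra.TensorProduct.congr AlgEquiv.refl σ)).trans E.symm
  have hτ : ∀ M : M2 Γ(X, ⊤), τ (f.appTop.hom.mapMatrix M) = f.appTop.hom.mapMatrix (σ M) := by
    intro M
    rw [← hE, ← hE]
    simp [τ]
  refine ⟨AlgEquiv.ofRingEquiv (f := τ.toRingEquiv) fun a => ?_, fun g => ?_⟩
  · have h1 : algebraMap Γ(Y, ⊤) (M2 Γ(Y, ⊤)) a = E.symm (a ⊗ₜ 1) := by
      rw [matrixEquivTensor_apply_symm, Algebra.algebraMap_eq_smul_one]
      simp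
    change τ _ = _
    rw [h1]
    simp [τ]
  · change τ _ = _
    rw [Rep.pullback_apply, Rep.pullback_apply, hτ, hσ]

end BaseChange

/-! ### The moduli functor -/

/-- The field `𝔽₂` (in the universe at hand). -/
abbrev F2 : Type u := ULift.{u} (ZMod 2)

/-- The scheme `Spec 𝔽₂`. -/
noncomputable abbrev SpecF2 : Scheme.{u} := Spec (CommRingCat.of F2.{u})

section Functor

variable (G : Type u) [Monoid G]

/-- Equivalence of representations with unipotent mold over `𝔽₂`, as a setoid. -/
def repSetoid (X : Scheme.{u}) : Setoid {ρ : Rep G X // ρ.IsUnipotentF2} where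
  r ρ ρ' := ρ.1.Equivalent ρ'.1
  iseqv :=
    { refl := fun _ => ⟨AlgEquiv.refl, fun _ => rfl⟩
      symm := fun ⟨σ, h⟩ => ⟨σ.symm, fun g => by rw [← h, AlgEquiv.symm_apply_apply]⟩
      trans := fun ⟨σ, h⟩ ⟨τ, h'⟩ => ⟨σ.trans τ, fun g => by rw [AlgEquiv.trans_apply, h, h']⟩ }

/-- Equivalence classes of representations with unipotent mold over `𝔽₂` on `X`. -/
abbrev RepClass (X : Scheme.{u}) : Type u := Quotient (repSetoid G X)

variable {G} in
/-- The class of a representation with unipotent mold over `𝔽₂`. -/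
def Rep.toClass {X : Scheme.{u}} (ρ : Rep G X) (h : ρ.IsUnipotentF2) : RepClass G X :=
  Quotient.mk (repSetoid G X) ⟨ρ, h⟩

variable {G} in
/-- Pullback of equivalence classes. -/
noncomputable def RepClass.pullback {X Y : Scheme.{u}} (f : Y ⟶ X) :
    RepClass G X → RepClass G Y :=
  Quotient.map (fun ρ => ⟨ρ.1.pullback f, ρ.2.pullback f⟩) fun _ _ h => h.pullback f

/-- The presheaf on `𝔽₂`-schemes sending `X` to the set of equivalence classes of representations
of `G` with unipotent mold over `𝔽₂` on `X`. -/
noncomputable def repClassFunctor : (Over SpecF2.{u})ᵒᵖ ⥤ Type u where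
  obj X := RepClass G X.unop.left
  map f := TypeCat.ofHom (RepClass.pullback f.unop.left)
  map_id X := by
    ext c
    induction c using Quotient.inductionOn with
    | _ ρ =>
      refine congrArg (Quotient.mk (repSetoid G _)) (Subtype.ext ?_)
      ext g i j
      rfl
  map_comp f f' := by
    ext c
    induction c using Quotient.inductionOn with
    | _ ρ =>
      refine congrArg (Quotient.mk (repSetoid G _)) (Subtype.ext ?_)
      ext g i j
      exact congrArg (fun φ => φ.hom (ρ.1 g i j)) (Scheme.Hom.comp_appTop f'.unop.left f.unop.left)

/-- The sheafification of the presheaf of equivalence classes of representations with unipotent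
mold over `𝔽₂`, for the Zariski topology on the category of `𝔽₂`-schemes. (The category is large,
so that the values have to be moved up one universe.) -/
noncomputable def eqU2F2 : (Over SpecF2.{u})ᵒᵖ ⥤ Type (u + 1) :=
  sheafify (Scheme.zariskiTopology.{u}.over SpecF2.{u})
    (repClassFunctor G ⋙ uliftFunctor.{u + 1, u})

variable {G} in
/-- The element of the sheafification given by a representation on an `𝔽₂`-scheme. -/
noncomputable def eqU2F2.mk {X : Over SpecF2.{u}} (ρ : Rep G X.left) (h : ρ.IsUnipotentF2) :
    (eqU2F2 G).obj (op X) :=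
  (toSheafify (Scheme.zariskiTopology.{u}.over SpecF2.{u})
    (repClassFunctor G ⋙ uliftFunctor.{u + 1, u})).app (op X) (ULift.up (ρ.toClass h))

end Functor

/-! ### `(a, b)`-coefficients and the rings that parametrize them -/

section Coefficients

variable {G : Type u} [Monoid G]

/-- A character `d : G → R` together with `(a, b)`-coefficients with respect to `(d, α)`
(used for rings `R` over `𝔽₂`). -/
@[ext]
structure ABCoeff (G : Type u) [Monoid G] (α : G) (R : Type*) [CommRing R] where
  d : G →* R
  a : G → R
  b : G → R
  a_one : a 1 = 1
  b_one : b 1 = 0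
  a_base : a α = 0
  b_base : b α = 1
  a_mul : ∀ g h, a (g * h) = a g * a h + b g * b h * d α
  b_mul : ∀ g h, b (g * h) = a g * b h + b g * a h
  norm : ∀ g, a g ^ 2 + b g ^ 2 * d α = d g

namespace ABCoeff

variable {α : G} {R S : Type*} [CommRing R] [CommRing S]

/-- The image of `(a, b)`-coefficients under a ring homomorphism. -/
def map (φ : R →+* S) (c : ABCoeff G α R) : ABCoeff G α S where
  d := φ.toMonoidHom.comp c.d
  a g := φ (c.a g)
  b g := φ (c.b g)
  a_one := by rw [c.a_one, map_one]
  b_one := by rw [c.b_one, map_zero]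
  a_base := by rw [c.a_base, map_zero]
  b_base := by rw [c.b_base, map_one]
  a_mul g h := by rw [c.a_mul]; simp
  b_mul g h := by rw [c.b_mul]; simp
  norm g := by
    have := congrArg φ (c.norm g)
    simpa using this

/-- Change of the base element: if `u` is inverse to `b(β)`, the coefficients with respect to
`(d, β)` are `g ↦ a(g) + a(β) b(β)⁻¹ b(g)` and `g ↦ b(g) b(β)⁻¹`. -/
def change (h2 : (2 : R) = 0) (c : ABCoeff G α R) (β : G) (u : R) (hu : c.b β * u = 1) :
    ABCoeff G β R where
  d := c.d
  a g := c.a g + c.a β * u * c.b g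
  b g := c.b g * u
  a_one := by rw [c.a_one, c.b_one]; ring
  b_one := by rw [c.b_one]; ring
  a_base := by linear_combination c.a β * hu + c.a β * h2
  b_base := hu
  a_mul g h := by
    rw [c.a_mul, c.b_mul, ← c.norm β]
    linear_combination (-c.b g * c.b h * c.d α * (1 + c.b β * u)) * hu
      - c.a β ^ 2 * u ^ 2 * c.b g * c.b h * h2
  b_mul g h := by
    rw [c.b_mul]
    linear_combination (-c.a β * u ^ 2 * c.b g * c.b h) * h2
  norm g := by
    rw [← c.norm g, ← c.norm β]
    linear_combination (c.b g ^ 2 * c.d α * (1 + c.b β * u)) * hu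
      + (c.a g * c.a β * u * c.b g + c.a β ^ 2 * u ^ 2 * c.b g ^ 2) * h2

end ABCoeff

variable (G) in
/-- The relations of a character. -/
inductive CharRel : MvPolynomial G F2.{u} → Prop
  | one : CharRel (MvPolynomial.X 1 - 1)
  | mul (g h : G) : CharRel (MvPolynomial.X (g * h) - MvPolynomial.X g * MvPolynomial.X h)

variable (G) in
/-- The coordinate ring of the scheme of characters of `G` over `𝔽₂`. -/
def A1 : Type u := MvPolynomial G F2.{u} ⧸ Ideal.span {p | CharRel G p}

noncomputable instance : CommRing (A1 G) :=
  inferInstanceAs (CommRing (MvPolynomial G F2.{u} ⧸ Ideal.span {p | CharRel G p}))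

noncomputable instance : Algebra F2.{u} (A1 G) :=
  inferInstanceAs (Algebra F2.{u} (MvPolynomial G F2.{u} ⧸ Ideal.span {p | CharRel G p}))

variable (G) in
/-- The quotient map onto the coordinate ring of characters. -/
noncomputable def A1.mk : MvPolynomial G F2.{u} →+* A1 G := Ideal.Quotient.mk _

lemma A1.mk_eq_zero {p : MvPolynomial G F2.{u}} (h : CharRel G p) : A1.mk G p = 0 :=
  Ideal.Quotient.eq_zero_iff_mem.2 (Ideal.subset_span h)

variable (G) in
/-- The universal character. -/
noncomputable def univChar : G →* A1 G where
  toFun g := A1.mk G (MvPolynomial.X g)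
  map_one' := by
    have := A1.mk_eq_zero (G := G) .one
    rwa [map_sub, map_one, sub_eq_zero] at this
  map_mul' g h := by
    have := A1.mk_eq_zero (.mul g h)
    rwa [map_sub, map_mul, sub_eq_zero] at this

/-- The indeterminate `a(g)`. -/
noncomputable abbrev varA (g : G) : MvPolynomial (G ⊕ G) (A1 G) := MvPolynomial.X (Sum.inl g)

/-- The indeterminate `b(g)`. -/
noncomputable abbrev varB (g : G) : MvPolynomial (G ⊕ G) (A1 G) := MvPolynomial.X (Sum.inr g)

/-- The value of the universal character as a constant polynomial. -/
noncomputable abbrev constD (g : G) : MvPolynomial (G ⊕ G) (A1 G) :=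
  MvPolynomial.C (univChar G g)

/-- The relations of `(a, b)`-coefficients with respect to the universal character and `α`. -/
inductive CoeffRel (α : G) : MvPolynomial (G ⊕ G) (A1 G) → Prop
  | a_one : CoeffRel α (varA 1 - 1)
  | b_one : CoeffRel α (varB 1)
  | a_base : CoeffRel α (varA α)
  | b_base : CoeffRel α (varB α - 1)
  | a_mul (g h : G) : CoeffRel α (varA (g * h) - varA g * varA h - varB g * varB h * constD α)
  | b_mul (g h : G) : CoeffRel α (varB (g * h) - varA g * varB h - varB g * varA h)
  | norm (g : G) : CoeffRel α (varA g ^ 2 - varB g ^ 2 * constD α - constD g)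

/-- The ring parametrizing `(a, b)`-coefficients with respect to `(d, α)`, `d` a character. -/
def A2 (α : G) : Type u := MvPolynomial (G ⊕ G) (A1 G) ⧸ Ideal.span {p | CoeffRel α p}

noncomputable instance (α : G) : CommRing (A2 α) :=
  inferInstanceAs (CommRing (MvPolynomial (G ⊕ G) (A1 G) ⧸ Ideal.span {p | CoeffRel α p}))

noncomputable instance (α : G) : Algebra (A1 G) (A2 α) :=
  inferInstanceAs (Algebra (A1 G) (MvPolynomial (G ⊕ G) (A1 G) ⧸ Ideal.span {p | CoeffRel α p}))

noncomputable instance (α : G) : Algebra F2.{u} (A2 α) :=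
  inferInstanceAs (Algebra F2.{u} (MvPolynomial (G ⊕ G) (A1 G) ⧸ Ideal.span {p | CoeffRel α p}))

/-- The quotient map onto the ring parametrizing `(a, b)`-coefficients. -/
noncomputable def A2.mk (α : G) : MvPolynomial (G ⊕ G) (A1 G) →+* A2 α := Ideal.Quotient.mk _

lemma A2.mk_eq_zero {α : G} {p : MvPolynomial (G ⊕ G) (A1 G)} (h : CoeffRel α p) :
    A2.mk α p = 0 :=
  Ideal.Quotient.eq_zero_iff_mem.2 (Ideal.subset_span h)

lemma two_eq_zero (R : Type*) [CommRing R] [Algebra F2.{u} R] : (2 : R) = 0 := by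
  have h : (2 : F2.{u}) = 0 := ULift.down_injective (by decide)
  have := congrArg (algebraMap F2.{u} R) h
  rwa [map_ofNat, map_zero] at this

/-- The universal `(a, b)`-coefficients with respect to `α`. -/
noncomputable def univCoeff (α : G) : ABCoeff G α (A2 α) where
  d := (algebraMap (A1 G) (A2 α)).toMonoidHom.comp (univChar G)
  a g := A2.mk α (varA g)
  b g := A2.mk α (varB g)
  a_one := by
    have := A2.mk_eq_zero (CoeffRel.a_one (α := α))
    rwa [map_sub, map_one, sub_eq_zero] at this
  b_one := A2.mk_eq_zero CoeffRel.b_one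
  a_base := A2.mk_eq_zero CoeffRel.a_base
  b_base := by
    have := A2.mk_eq_zero (CoeffRel.b_base (α := α))
    rwa [map_sub, map_one, sub_eq_zero] at this
  a_mul g h := by
    have := A2.mk_eq_zero (CoeffRel.a_mul (α := α) g h)
    rw [map_sub, map_sub, map_mul, map_mul, map_mul, sub_sub, sub_eq_zero] at this
    exact this
  b_mul g h := by
    have := A2.mk_eq_zero (CoeffRel.b_mul (α := α) g h)
    rw [map_sub, map_sub, map_mul, map_mul, sub_sub, sub_eq_zero] at this
    exact this
  norm g := by
    have h1 := A2.mk_eq_zero (CoeffRel.norm (α := α) g)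
    rw [map_sub, map_sub, map_mul, map_pow, map_pow] at h1
    have h2 := two_eq_zero.{u} (A2 α)
    change A2.mk α (varA g) ^ 2 + A2.mk α (varB g) ^ 2 * A2.mk α (constD α) = A2.mk α (constD g)
    linear_combination h1 + A2.mk α (varB g) ^ 2 * A2.mk α (constD α) * h2

/-- The homomorphism on the coordinate ring of characters given by a character. -/
noncomputable def charLift {R : Type*} [CommRing R] [Algebra F2.{u} R] (d : G →* R) :
    A1 G →+* R :=
  Ideal.Quotient.lift (Ideal.span {p | CharRel G p}) (MvPolynomial.eval₂Hom (algebraMap F2.{u} R) d) (by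
    intro p hp
    rw [← RingHom.mem_ker]
    refine (Ideal.span_le (I := RingHom.ker _)).2 ?_ hp
    rintro _ (_ | ⟨g, h⟩) <;> simp [RingHom.mem_ker])

/-- The homomorphism `A2 α → R` given by `(a, b)`-coefficients in an `𝔽₂`-algebra `R`. -/
noncomputable def coeffLift {α : G} {R : Type*} [CommRing R] [Algebra F2.{u} R]
    (c : ABCoeff G α R) : A2 α →+* R :=
  Ideal.Quotient.lift (Ideal.span {p | CoeffRel α p})
    (MvPolynomial.eval₂Hom (charLift c.d) (Sum.elim c.a c.b)) (by
    have hd : ∀ g, charLift c.d (univChar G g) = c.d g := fun g =>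
      (Ideal.Quotient.lift_mk _ _ _).trans (MvPolynomial.eval₂Hom_X' _ _ _)
    have h2 := two_eq_zero.{u} R
    intro p hp
    rw [← RingHom.mem_ker]
    refine (Ideal.span_le (I := RingHom.ker _)).2 ?_ hp
    rintro _ (_ | _ | _ | _ | ⟨g, h⟩ | ⟨g, h⟩ | g)
    · simp [RingHom.mem_ker, c.a_one]
    · simp [RingHom.mem_ker, c.b_one]
    · simp [RingHom.mem_ker, c.a_base]
    · simp [RingHom.mem_ker, c.b_base]
    · simp [RingHom.mem_ker, c.a_mul, hd]
    · simp [RingHom.mem_ker, c.b_mul]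
    · simp [RingHom.mem_ker, hd, ← c.norm g]
      linear_combination (-(c.b g) ^ 2 * c.d α) * h2)

/-- The affine `𝔽₂`-scheme parametrizing `(a, b)`-coefficients with respect to `(d, α)`. -/
noncomputable def chart (α : G) : Over SpecF2.{u} :=
  Over.mk (Spec.map (CommRingCat.ofHom (algebraMap F2.{u} (A2 α))))

/-- The `(a, b)`-coefficients on an `𝔽₂`-scheme `X` given by a morphism to the chart of `α`:
the pullback of the universal ones. -/
noncomputable def coeffOf {α : G} {X : Over SpecF2.{u}} (f : X ⟶ chart α) :
    ABCoeff G α Γ(X.left, ⊤) :=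
  (univCoeff α).map
    ((Scheme.ΓSpecIso (CommRingCat.of (A2 α))).inv ≫ Scheme.Hom.appTop f.left).hom

/-- The coordinate ring `A2 α [b(β)⁻¹]` of the open subset `b(β) ≠ 0` of the chart of `α`. -/
abbrev overlapRing (α β : G) : Type u := Localization.Away ((univCoeff α).b β)

/-- The homomorphism `A2 β → A2 α [b(β)⁻¹]` giving the morphism from the open subset `b(β) ≠ 0` of
the chart of `α` to the chart of `β`: it changes the base element of the coefficients. -/
noncomputable def transition (α β : G) : A2 β →+* overlapRing α β :=
  coeffLift (((univCoeff α).map (algebraMap (A2 α) (overlapRing α β))).change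
    (two_eq_zero.{u} _) β (IsLocalization.Away.invSelf ((univCoeff α).b β))
    (IsLocalization.Away.mul_invSelf _))

/-- `Ch`, together with the morphisms `ι α`, is obtained by gluing the charts along the open
subsets `b_α(β) ≠ 0` of the chart of `α` and the transition morphisms: the `ι α` are open
immersions, they cover `Ch`, and the intersection of the charts of `α` and `β` is the open
subset `b_α(β) ≠ 0` of the chart of `α`, embedded in the chart of `β` by the transition. -/
structure IsGluing (Ch : Over SpecF2.{u}) (ι : ∀ α : G, chart α ⟶ Ch) : Prop where
  isOpenImmersion : ∀ α, IsOpenImmersion (ι α).left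
  cover : ∀ x : Ch.left, ∃ (α : G) (y : (chart α).left), (ι α).left y = x
  overlap : ∀ α β : G, IsPullback
    (Spec.map (CommRingCat.ofHom (algebraMap (A2 α) (overlapRing α β))))
    (Spec.map (CommRingCat.ofHom (transition α β))) (ι α).left (ι β).left

/-- The `(a, b)`-coefficients `c` are those of the representation `ρ` with respect to its
determinant character and the matrix `ρ(α)`. -/
def ABCoeff.IsOf {α : G} {X : Scheme.{u}} (c : ABCoeff G α Γ(X, ⊤)) (ρ : Rep G X) : Prop :=
  ∀ g, c.d g = (ρ g).det ∧ ρ g = c.a g • (1 : M2 Γ(X, ⊤)) + c.b g • ρ α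

end Coefficients

end UnipotentModuli

/-!
Throughout, `2 = 0`, so a `2 × 2` matrix `M` of trace zero satisfies `M² = det(M)`.

The charts `Spec A_α` represent `(a, b)`-coefficients by construction of the rings `A2 α`
(`coeffOf_bijective`). The central notion is the relation `ABCoeff.Rebase` between coefficients with
respect to `α` and with respect to `β`: the latter arise from the former by the transition formulas,
for some inverse of `b(β)`. This relation is reflexive, symmetric and transitive, and a pair of
morphisms to the charts of `α` and `β` lifts to the overlap exactly if the corresponding
coefficients are related (`exists_overlap_lift_iff_rebase`). Hence the transition morphisms satisfy
the cocycle condition, so that the charts can be glued (`isGluing_moduli`), and two morphisms to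
charts become equal in any gluing exactly if their coefficients are related
(`IsGluing.comp_eq_comp_iff`).

Let `ρ` be a representation with unipotent mold. At the residue field of a point, the algebra
generated by `ρ` has rank `2`, so some `ρ(α)` is not scalar there. Near the point, `1` and `ρ(α)`
then form a basis of the algebra, and the coordinates of the matrices `ρ(g)` are coefficients with
respect to `α` (`Rep.IsUnipotentF2.exists_coeff`). Coefficients of `ρ` with respect to different
elements are related (`ABCoeff.IsOf.rebase`), so the morphisms to the charts that they give agree
in the gluing and descend to a morphism `X ⟶ Ch` (`IsGluing.exists_classifies`), which depends on
the equivalence class of `ρ` only. Conversely, coefficients `(d, a, b)` with respect to `α` belong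
to the companion representation `ABCoeff.toRep`, which sends `α` to the companion matrix of
`T² - d(α)`. A trace zero matrix that is not scalar at a point has a cyclic vector near the point,
so it is conjugate there to its companion matrix; hence each representation with the given
coefficients is locally equivalent to the companion representation
(`ABCoeff.IsOf.exists_equivalent_toRep`). Therefore the morphism of presheaves from equivalence
classes to morphisms into `Ch` is locally injective and locally surjective. As its target is a
sheaf, it identifies the sheafification with the functor of points of `Ch`
(`IsGluing.exists_representableBy`).

The inverse of `b_α(β)` on the overlap is `b_β(α)`, a function on the chart of `β`. So the functions
on the overlap are generated by those on the two charts, and the diagonal is a closed immersion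
(`IsGluing.isSeparated`). If `s` generates `G`, then the product rule for `b` shows that the
functions `b_α(g)`, `g ∈ s`, have no common zero, so that the charts of the elements of `s` cover
`Ch`, and the product rules for `a` and `b` and the norm relation show that `A2 α` is generated by
`d(α)` and the functions `a_α(g)`, `b_α(g)` with `g ∈ s` (`IsGluing.quasiCompact`,
`IsGluing.locallyOfFiniteType`).
-/

namespace UnipotentModuli

variable {G : Type u} [Monoid G]

/-! ### Change of the base element of `(a, b)`-coefficients -/

namespace ABCoeff

variable {α β γ : G} {R S : Type*} [CommRing R] [CommRing S]

/-- The coefficients `c'` arise from `c` by changing the base element from `α` to `β`. In contrast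
to `ABCoeff.change`, this is a relation and does not carry the inverse of `b(β)` as a datum. -/
def Rebase (c : ABCoeff G α R) (c' : ABCoeff G β R) : Prop :=
  c'.d = c.d ∧ ∃ u, c.b β * u = 1 ∧ (∀ g, c'.a g = c.a g + c.a β * u * c.b g) ∧
    ∀ g, c'.b g = c.b g * u

lemma rebase_change (h2 : (2 : R) = 0) (c : ABCoeff G α R) (u : R) (hu : c.b β * u = 1) :
    c.Rebase (c.change h2 β u hu) :=
  ⟨rfl, u, hu, fun _ => rfl, fun _ => rfl⟩

lemma Rebase.isUnit {c : ABCoeff G α R} {c' : ABCoeff G β R} (h : c.Rebase c') :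
    IsUnit (c.b β) := by
  obtain ⟨-, u, hu, -⟩ := h
  exact IsUnit.of_mul_eq_one u hu

lemma Rebase.b_mul_b {c : ABCoeff G α R} {c' : ABCoeff G β R} (h : c.Rebase c') :
    c.b β * c'.b α = 1 := by
  obtain ⟨-, u, hu, -, hb⟩ := h
  rw [hb, c.b_base, one_mul, hu]

lemma Rebase.unique {c : ABCoeff G α R} {c' c'' : ABCoeff G β R} (h : c.Rebase c')
    (h' : c.Rebase c'') : c' = c'' := by
  obtain ⟨hd, u, hu, ha, hb⟩ := h
  obtain ⟨hd', v, hv, ha', hb'⟩ := h'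
  obtain rfl : u = v := by linear_combination v * hu - u * hv
  exact ABCoeff.ext (hd.trans hd'.symm) (funext fun g => (ha g).trans (ha' g).symm)
    (funext fun g => (hb g).trans (hb' g).symm)

lemma Rebase.refl (c : ABCoeff G α R) : c.Rebase c :=
  ⟨rfl, 1, by rw [c.b_base, one_mul], fun g => by rw [c.a_base]; ring, fun g => by ring⟩

lemma Rebase.symm (h2 : (2 : R) = 0) {c : ABCoeff G α R} {c' : ABCoeff G β R}
    (h : c.Rebase c') : c'.Rebase c := by
  obtain ⟨hd, u, hu, ha, hb⟩ := h
  refine ⟨hd.symm, c.b β, ?_, fun g => ?_, fun g => ?_⟩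
  · rw [hb, c.b_base, one_mul, mul_comm, hu]
  · rw [ha, ha, hb, c.a_base, c.b_base]
    linear_combination -c.a β * c.b g * u * hu - c.a β * u * c.b g * h2
  · rw [hb]
    linear_combination -c.b g * hu

lemma Rebase.trans (h2 : (2 : R) = 0) {c : ABCoeff G α R} {c' : ABCoeff G β R}
    {c'' : ABCoeff G γ R} (h : c.Rebase c') (h' : c'.Rebase c'') : c.Rebase c'' := by
  obtain ⟨hd, u, hu, ha, hb⟩ := h
  obtain ⟨hd', v, hv, ha', hb'⟩ := h'
  rw [hb] at hv
  refine ⟨hd'.trans hd, u * v, by rw [← mul_assoc, hv], fun g => ?_, fun g => ?_⟩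
  · rw [ha', ha, ha, hb]
    linear_combination c.a β * u * c.b g * hv + c.a β * u * c.b g * h2
  · rw [hb', hb, mul_assoc]

lemma Rebase.map {c : ABCoeff G α R} {c' : ABCoeff G β R} (h : c.Rebase c') (φ : R →+* S) :
    (c.map φ).Rebase (c'.map φ) := by
  obtain ⟨hd, u, hu, ha, hb⟩ := h
  refine ⟨by simp [ABCoeff.map, hd], φ u, ?_, fun g => ?_, fun g => ?_⟩
  · simp [ABCoeff.map, ← map_mul, hu]
  · simp [ABCoeff.map, ha]
  · simp [ABCoeff.map, hb]

lemma map_map {T : Type*} [CommRing T] (c : ABCoeff G α R) (φ : R →+* S) (ψ : S →+* T) :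
    (c.map φ).map ψ = c.map (ψ.comp φ) := rfl

/-- If `b` vanishes on generators of the monoid, it vanishes, by the product rule for `b`;
this contradicts `b(α) = 1`. -/
lemma exists_b_ne_zero [Nontrivial R] (c : ABCoeff G α R) {s : Set G}
    (hs : Submonoid.closure s = ⊤) : ∃ g ∈ s, c.b g ≠ 0 := by
  by_contra! H
  have h : ∀ g, c.b g = 0 := by
    intro g
    have hg : g ∈ Submonoid.closure s := hs ▸ Submonoid.mem_top g
    induction hg using Submonoid.closure_induction with
    | mem g hg => exact H g hg
    | one => exact c.b_one
    | mul g h _ _ hg hh => rw [c.b_mul, hg, hh, mul_zero, zero_mul, add_zero]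
  exact one_ne_zero (c.b_base.symm.trans (h α))

end ABCoeff

/-! ### The universal property of the coordinate rings -/

section Universal

variable {α β : G} {R : Type*} [CommRing R]

lemma two_eq_zero_of_ringHom (φ : A2 α →+* R) : (2 : R) = 0 := by
  have := congrArg φ (two_eq_zero.{u} (A2 α))
  rwa [map_ofNat, map_zero] at this

lemma F2.subsingleton_ringHom : Subsingleton (F2.{u} →+* R) :=
  ⟨fun φ ψ => RingHom.ext fun x => by
    have := congrArg (fun χ => χ x.down) (Subsingleton.elim
      (φ.comp (ULift.ringEquiv (R := ZMod 2)).symm.toRingHom)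
      (ψ.comp (ULift.ringEquiv (R := ZMod 2)).symm.toRingHom))
    exact this⟩

lemma A1.hom_ext {φ ψ : A1 G →+* R} (h : ∀ g, φ (univChar G g) = ψ (univChar G g)) : φ = ψ := by
  refine Ideal.Quotient.ringHom_ext (MvPolynomial.ringHom_ext (fun x => ?_) h)
  have := F2.subsingleton_ringHom.elim
    ((φ.comp (A1.mk G)).comp (MvPolynomial.C (R := F2.{u}) (σ := G)))
    ((ψ.comp (A1.mk G)).comp (MvPolynomial.C (R := F2.{u}) (σ := G)))
  exact congrArg (fun χ => χ x) this

lemma A2.hom_ext {φ ψ : A2 α →+* R} (h : (univCoeff α).map φ = (univCoeff α).map ψ) :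
    φ = ψ := by
  refine Ideal.Quotient.ringHom_ext (MvPolynomial.ringHom_ext (fun x => ?_) ?_)
  · have : φ.comp (algebraMap (A1 G) (A2 α)) = ψ.comp (algebraMap (A1 G) (A2 α)) :=
      A1.hom_ext fun g => congrArg (fun c => c.d g) h
    exact congrArg (fun χ => χ x) this
  · rintro (g | g)
    · exact congrArg (fun c => c.a g) h
    · exact congrArg (fun c => c.b g) h

lemma univCoeff_map_coeffLift [Algebra F2.{u} R] (c : ABCoeff G α R) :
    (univCoeff α).map (coeffLift c) = c := by
  refine ABCoeff.ext (MonoidHom.ext fun g => ?_) (funext fun g => ?_) (funext fun g => ?_)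
  · have h1 : coeffLift c (A2.mk α (MvPolynomial.C (univChar G g))) = charLift c.d (univChar G g) :=
      (Ideal.Quotient.lift_mk _ _ _).trans (MvPolynomial.eval₂Hom_C _ _ _)
    exact h1.trans ((Ideal.Quotient.lift_mk _ _ _).trans (MvPolynomial.eval₂Hom_X' _ _ _))
  · exact (Ideal.Quotient.lift_mk _ _ _).trans (MvPolynomial.eval₂Hom_X' _ _ _)
  · exact (Ideal.Quotient.lift_mk _ _ _).trans (MvPolynomial.eval₂Hom_X' _ _ _)

variable (α β) in
/-- The universal coefficients on the chart of `α` and the pullback of those on the chart of `β`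
are related on the overlap. -/
lemma rebase_transition : ((univCoeff α).map (algebraMap (A2 α) (overlapRing α β))).Rebase
    ((univCoeff β).map (transition α β)) := by
  rw [transition, univCoeff_map_coeffLift]
  exact ABCoeff.rebase_change _ _ _ _

/-- A pair of points of the charts of `α` and `β` lifts to the overlap if and only if the
corresponding coefficients are related by the change of the base element. -/
lemma exists_overlap_lift_iff {φ : A2 α →+* R} {ψ : A2 β →+* R} :
    (∃ χ : overlapRing α β →+* R, χ.comp (algebraMap _ _) = φ ∧ χ.comp (transition α β) = ψ) ↔
      ((univCoeff α).map φ).Rebase ((univCoeff β).map ψ) := by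
  constructor
  · rintro ⟨χ, rfl, rfl⟩
    exact (rebase_transition α β).map χ
  · intro h
    have hφ : (IsLocalization.Away.lift (S := overlapRing α β) ((univCoeff α).b β)
        (g := φ) h.isUnit).comp (algebraMap _ _) = φ := IsLocalization.Away.lift_comp _ _
    refine ⟨IsLocalization.Away.lift ((univCoeff α).b β) (g := φ) h.isUnit, hφ, A2.hom_ext ?_⟩
    have h' := (rebase_transition α β).map
      (IsLocalization.Away.lift (S := overlapRing α β) ((univCoeff α).b β) (g := φ) h.isUnit)
    rw [ABCoeff.map_map, hφ, ABCoeff.map_map] at h'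
    exact h'.unique h

end Universal

/-! ### The companion representation -/

namespace ABCoeff

variable {α : G} {R S : Type*} [CommRing R] [CommRing S]

/-- The companion matrix of `T² - d`. -/
def companion (d : R) : M2 R := !![0, d; 1, 0]

lemma companion_mul_self (d : R) : companion d * companion d = d • (1 : M2 R) := by
  ext i j; fin_cases i <;> fin_cases j <;> simp [companion]

/-- The representation with given coefficients for which the matrix of `α` is a companion matrix. -/
def toRep (c : ABCoeff G α R) : G →* M2 R where
  toFun g := c.a g • (1 : M2 R) + c.b g • companion (c.d α)
  map_one' := by rw [c.a_one, c.b_one, one_smul, zero_smul, add_zero]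
  map_mul' g h := by
    rw [c.a_mul, c.b_mul, add_mul, mul_add, mul_add, smul_mul_smul_comm, smul_mul_smul_comm,
      smul_mul_smul_comm, smul_mul_smul_comm, companion_mul_self, one_mul, one_mul, mul_one]
    module

lemma toRep_apply (c : ABCoeff G α R) (g : G) :
    c.toRep g = c.a g • (1 : M2 R) + c.b g • companion (c.d α) := rfl

lemma toRep_base (c : ABCoeff G α R) : c.toRep α = companion (c.d α) := by
  rw [toRep_apply, c.a_base, c.b_base, zero_smul, one_smul, zero_add]

lemma det_toRep (h2 : (2 : R) = 0) (c : ABCoeff G α R) (g : G) : (c.toRep g).det = c.d g := by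
  rw [toRep_apply, Matrix.det_fin_two, ← c.norm g]
  simp [companion]
  linear_combination (-c.b g ^ 2 * c.d α) * h2

lemma toRep_map (c : ABCoeff G α R) (φ : R →+* S) (g : G) :
    (c.map φ).toRep g = φ.mapMatrix (c.toRep g) := by
  ext i j
  fin_cases i <;> fin_cases j <;> simp [toRep_apply, companion, ABCoeff.map]

lemma frame_toRep (h2 : (2 : R) = 0) (c : ABCoeff G α R) :
    Frame c.toRep 2 ![1, companion (c.d α)] ![!![1, 0; 0, 0], !![0, 1; 0, 0]] where
  dual := by
    refine ⟨Sum.elim ![!![0, 0; 0, 1], !![0, 0; 1, 0]]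
      ![!![1, 0; 0, -1], !![0, 1; -c.d α, 0]], ?_, ?_⟩
    · rintro (k | k) (l | l) <;> fin_cases k <;> fin_cases l <;>
        simp [companion, Fin.sum_univ_two]
    · intro i j i' j'
      fin_cases i <;> fin_cases j <;> fin_cases i' <;> fin_cases j' <;>
        simp [companion, Fin.sum_univ_two]
  mem k := by
    fin_cases k
    · exact one_mem _
    · exact Algebra.subset_adjoin ⟨α, c.toRep_base⟩
  gen g := ⟨![c.a g, c.b g], by simp [toRep_apply, Fin.sum_univ_two]⟩
  one := ⟨![1, 0], by simp [Fin.sum_univ_two]⟩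
  mul k l := by
    fin_cases k <;> fin_cases l
    · exact ⟨![1, 0], by simp [Fin.sum_univ_two]⟩
    · exact ⟨![0, 1], by simp [Fin.sum_univ_two]⟩
    · exact ⟨![0, 1], by simp [Fin.sum_univ_two]⟩
    · exact ⟨![c.d α, 0], by simp [Fin.sum_univ_two, companion_mul_self]⟩
  trace k := by
    fin_cases k
    · simpa [Matrix.trace_fin_two] using h2
    · simp [companion, Matrix.trace_fin_two]

end ABCoeff

/-! ### Morphisms to the charts -/

section Points

/-- The ring homomorphism corresponding to a morphism to an affine scheme. -/
noncomputable def globalHom {T : Scheme.{u}} {R : Type u} [CommRing R]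
    (g : T ⟶ Spec (CommRingCat.of R)) : R →+* Γ(T, ⊤) :=
  ((Scheme.ΓSpecIso (CommRingCat.of R)).inv ≫ g.appTop).hom

variable {T T' : Scheme.{u}} {R S : Type u} [CommRing R] [CommRing S]

lemma globalHom_injective {g g' : T ⟶ Spec (CommRingCat.of R)}
    (h : globalHom g = globalHom g') : g = g' := by
  refine ext_of_isAffine ?_
  rw [← cancel_epi (Scheme.ΓSpecIso (CommRingCat.of R)).inv]
  exact CommRingCat.hom_ext h

lemma globalHom_surjective (φ : R →+* Γ(T, ⊤)) :
    ∃ g : T ⟶ Spec (CommRingCat.of R), globalHom g = φ := by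
  refine ⟨T.toSpecΓ ≫ Spec.map (CommRingCat.ofHom φ), ?_⟩
  rw [globalHom, Scheme.Hom.comp_appTop, ← Scheme.ΓSpecIso_inv_naturality_assoc,
    Scheme.toSpecΓ_appTop, Iso.inv_hom_id, Category.comp_id, CommRingCat.hom_ofHom]

lemma globalHom_comp (h : T' ⟶ T) (g : T ⟶ Spec (CommRingCat.of R)) :
    globalHom (h ≫ g) = h.appTop.hom.comp (globalHom g) := by
  rw [globalHom, Scheme.Hom.comp_appTop]; rfl

lemma globalHom_comp_specMap (g : T ⟶ Spec (CommRingCat.of S)) (φ : R →+* S) :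
    globalHom (g ≫ Spec.map (CommRingCat.ofHom φ)) = (globalHom g).comp φ := by
  rw [globalHom, Scheme.Hom.comp_appTop, ← Scheme.ΓSpecIso_inv_naturality_assoc]; rfl

lemma SpecF2.hom_ext {f g : T ⟶ SpecF2.{u}} : f = g :=
  globalHom_injective (F2.subsingleton_ringHom.elim _ _)

/-- Morphisms of `𝔽₂`-schemes are morphisms of schemes. -/
noncomputable def homMkF2 {X Y : Over SpecF2.{u}} (f : X.left ⟶ Y.left) : X ⟶ Y :=
  Over.homMk f SpecF2.hom_ext

@[simp] lemma homMkF2_left {X Y : Over SpecF2.{u}} (f : X.left ⟶ Y.left) :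
    (homMkF2 f).left = f := rfl

/-- The functions on an `𝔽₂`-scheme form an `𝔽₂`-algebra, through the structure morphism. -/
noncomputable instance (X : Over SpecF2.{u}) : Algebra F2.{u} Γ(X.left, ⊤) :=
  (globalHom X.hom).toAlgebra

lemma two_eq_zero_global (X : Over SpecF2.{u}) : (2 : Γ(X.left, ⊤)) = 0 := two_eq_zero _

variable {α β γ : G}

/-- The coefficients given by a morphism of schemes to the chart of `α`. -/
noncomputable def coeff (g : T ⟶ Spec (CommRingCat.of (A2 α))) : ABCoeff G α Γ(T, ⊤) :=
  (univCoeff α).map (globalHom g)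

lemma coeff_left {X : Over SpecF2.{u}} (f : X ⟶ chart α) : coeff (α := α) f.left = coeffOf f := rfl

lemma coeff_injective {g g' : T ⟶ Spec (CommRingCat.of (A2 α))} (h : coeff g = coeff g') :
    g = g' :=
  globalHom_injective (A2.hom_ext h)

lemma coeff_comp (h : T' ⟶ T) (g : T ⟶ Spec (CommRingCat.of (A2 α))) :
    coeff (h ≫ g) = (coeff g).map h.appTop.hom := by
  rw [coeff, globalHom_comp]; rfl

lemma coeffOf_comp {X Y : Over SpecF2.{u}} (h : Y ⟶ X) (f : X ⟶ chart α) :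
    coeffOf (h ≫ f) = (coeffOf f).map h.left.appTop.hom :=
  coeff_comp h.left f.left

lemma coeffOf_bijective (α : G) (X : Over SpecF2.{u}) :
    Function.Bijective (coeffOf (α := α) (X := X)) := by
  refine ⟨fun f f' h => Over.OverMorphism.ext (coeff_injective h), fun c => ?_⟩
  obtain ⟨g, hg⟩ := globalHom_surjective (coeffLift c)
  refine ⟨homMkF2 g, ?_⟩
  change (univCoeff α).map (globalHom g) = c
  rw [hg, univCoeff_map_coeffLift]

end Points

/-! ### Gluing the charts -/

section Gluing

variable {T T' : Scheme.{u}} {α β γ : G}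

/-- The underlying scheme of the chart of `α`. -/
noncomputable abbrev chartScheme (α : G) : Scheme.{u} := Spec (CommRingCat.of (A2 α))

/-- The open subset `b(β) ≠ 0` of the chart of `α`. -/
noncomputable abbrev overlapScheme (α β : G) : Scheme.{u} :=
  Spec (CommRingCat.of (overlapRing α β))

/-- The inclusion of the overlap into the chart of `α`. -/
noncomputable abbrev overlapι (α β : G) : overlapScheme α β ⟶ chartScheme α :=
  Spec.map (CommRingCat.ofHom (algebraMap (A2 α) (overlapRing α β)))

/-- The transition morphism from the overlap to the chart of `β`. -/
noncomputable abbrev overlapTr (α β : G) : overlapScheme α β ⟶ chartScheme β :=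
  Spec.map (CommRingCat.ofHom (transition α β))

instance (α β : G) : IsOpenImmersion (overlapι α β) :=
  IsOpenImmersion.of_isLocalization ((univCoeff α).b β)

lemma two_eq_zero_of_hom (g : T ⟶ chartScheme α) : (2 : Γ(T, ⊤)) = 0 :=
  two_eq_zero_of_ringHom (globalHom g)

lemma exists_overlap_lift_iff_rebase {g : T ⟶ chartScheme α} {g' : T ⟶ chartScheme β} :
    (∃ h : T ⟶ overlapScheme α β, h ≫ overlapι α β = g ∧ h ≫ overlapTr α β = g') ↔
      (coeff g).Rebase (coeff g') := by
  rw [coeff, coeff, ← exists_overlap_lift_iff]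
  constructor
  · rintro ⟨h, rfl, rfl⟩
    exact ⟨globalHom h, (globalHom_comp_specMap _ _).symm, (globalHom_comp_specMap _ _).symm⟩
  · rintro ⟨χ, h1, h2⟩
    obtain ⟨h, rfl⟩ := globalHom_surjective χ
    exact ⟨h, globalHom_injective ((globalHom_comp_specMap _ _).trans h1),
      globalHom_injective ((globalHom_comp_specMap _ _).trans h2)⟩

lemma rebase_of_overlap (h : T ⟶ overlapScheme α β) :
    (coeff (h ≫ overlapι α β)).Rebase (coeff (h ≫ overlapTr α β)) :=
  exists_overlap_lift_iff_rebase.1 ⟨h, rfl, rfl⟩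

/-- The morphism to the overlap given by a pair of morphisms to the charts. -/
noncomputable def overlapLift (g : T ⟶ chartScheme α) (g' : T ⟶ chartScheme β)
    (h : (coeff g).Rebase (coeff g')) : T ⟶ overlapScheme α β :=
  (exists_overlap_lift_iff_rebase.2 h).choose

@[simp]
lemma overlapLift_ι (g : T ⟶ chartScheme α) (g' : T ⟶ chartScheme β)
    (h : (coeff g).Rebase (coeff g')) : overlapLift g g' h ≫ overlapι α β = g :=
  (exists_overlap_lift_iff_rebase.2 h).choose_spec.1

@[simp]
lemma overlapLift_tr (g : T ⟶ chartScheme α) (g' : T ⟶ chartScheme β)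
    (h : (coeff g).Rebase (coeff g')) : overlapLift g g' h ≫ overlapTr α β = g' :=
  (exists_overlap_lift_iff_rebase.2 h).choose_spec.2

/-- The overlap of the charts of `α` and `β`, seen from the chart of `β`. -/
noncomputable def overlapSwap (α β : G) : overlapScheme α β ⟶ overlapScheme β α :=
  overlapLift (overlapTr α β) (overlapι α β) (by
    have := rebase_of_overlap (𝟙 (overlapScheme α β))
    rw [Category.id_comp, Category.id_comp] at this
    exact this.symm (two_eq_zero_of_hom (overlapι α β)))

@[simp]
lemma overlapSwap_ι (α β : G) : overlapSwap α β ≫ overlapι β α = overlapTr α β :=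
  overlapLift_ι _ _ _

lemma overlapTr_self (α : G) : overlapTr α α = overlapι α α := by
  have := rebase_of_overlap (𝟙 (overlapScheme α α))
  rw [Category.id_comp, Category.id_comp] at this
  exact coeff_injective (this.unique (.refl _))

open Limits

/-- On a triple overlap, the coefficients of `β` and of `γ` are related, since both are related to
those of `α`. -/
lemma rebase_triple (α β γ : G) :
    (coeff (pullback.fst (overlapι α β) (overlapι α γ) ≫ overlapTr α β)).Rebase
      (coeff (pullback.snd (overlapι α β) (overlapι α γ) ≫ overlapTr α γ)) := by
  have h1 := rebase_of_overlap (pullback.fst (overlapι α β) (overlapι α γ))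
  have h2 := rebase_of_overlap (pullback.snd (overlapι α β) (overlapι α γ))
  rw [← pullback.condition] at h2
  have h := two_eq_zero_of_hom (pullback.fst (overlapι α β) (overlapι α γ) ≫ overlapι α β)
  exact (h1.symm h).trans h h2

/-- The transition morphism of triple overlaps. -/
noncomputable def tripleTr (α β γ : G) :
    pullback (overlapι α β) (overlapι α γ) ⟶ pullback (overlapι β γ) (overlapι β α) :=
  pullback.lift (overlapLift _ _ (rebase_triple α β γ)) (pullback.fst _ _ ≫ overlapSwap α β)
    (by rw [overlapLift_ι, Category.assoc, overlapSwap_ι])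

/-- The transition morphism of triple overlaps is compatible with the projection to the chart
of the second index. -/
lemma tripleTr_fst_ι (α β γ : G) :
    tripleTr α β γ ≫ pullback.fst _ _ ≫ overlapι β γ = pullback.fst _ _ ≫ overlapTr α β := by
  rw [tripleTr, pullback.lift_fst_assoc, overlapLift_ι]

/-- The transition morphism of triple overlaps is compatible with the projection to the chart
of the third index. -/
lemma tripleTr_fst_tr (α β γ : G) :
    tripleTr α β γ ≫ pullback.fst _ _ ≫ overlapTr β γ = pullback.snd _ _ ≫ overlapTr α γ := by
  rw [tripleTr, pullback.lift_fst_assoc, overlapLift_tr]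

/-- The transition morphism of triple overlaps is compatible with the projection to the chart
of the first index. -/
lemma tripleTr_snd_tr (α β γ : G) :
    tripleTr α β γ ≫ pullback.snd _ _ ≫ overlapTr β α = pullback.fst _ _ ≫ overlapι α β := by
  rw [tripleTr, pullback.lift_snd_assoc, Category.assoc, overlapSwap, overlapLift_tr]

/-- The gluing data of the charts. -/
noncomputable def glueData (G : Type u) [Monoid G] : Scheme.GlueData.{u} where
  J := G
  U := chartScheme
  V p := overlapScheme p.1 p.2
  f α β := overlapι α β
  f_mono α β := inferInstance
  f_hasPullback _ _ _ := inferInstance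
  f_id α := by
    have : IsIso (CommRingCat.ofHom (algebraMap (A2 α) (overlapRing α α))) :=
      (ConcreteCategory.isIso_iff_bijective _).2
        ((IsLocalization.atUnit (A2 α) (overlapRing α α) ((univCoeff α).b α)
          ((univCoeff α).b_base ▸ isUnit_one)).bijective)
    infer_instance
  t := overlapSwap
  t_id α := by
    rw [← cancel_mono (overlapι α α), overlapSwap_ι, overlapTr_self, Category.id_comp]
  t' := tripleTr
  t_fac α β γ := pullback.lift_snd _ _ _
  cocycle α β γ := by
    rw [← cancel_mono (pullback.fst (overlapι α β) (overlapι α γ)), ← cancel_mono (overlapι α β)]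
    simp only [Category.assoc, Category.id_comp]
    rw [tripleTr_fst_ι, tripleTr_fst_tr]
    exact tripleTr_snd_tr α β γ
  f_open α β := inferInstance

/-- The scheme `Ch₂(G)` over `𝔽₂`, glued from the charts. -/
noncomputable def moduli (G : Type u) [Monoid G] : Over SpecF2.{u} :=
  Over.mk ((glueData G).openCover.glueMorphisms (fun α : G => (chart α).hom)
    fun _ _ => SpecF2.hom_ext)

/-- The embedding of the chart of `α`. -/
noncomputable def moduliι (α : G) : chart α ⟶ moduli G :=
  homMkF2 ((glueData G).ι α)

variable (G) in
lemma isGluing_moduli : IsGluing (moduli G) moduliι where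
  isOpenImmersion α := (glueData G).ι_isOpenImmersion α
  cover := (glueData G).ι_jointly_surjective
  overlap α β := by
    have h := IsPullback.of_isLimit ((glueData G).vPullbackConeIsLimit α β)
    exact h.of_iso (Iso.refl _) (Iso.refl _) (Iso.refl _) (Iso.refl _)
      ((Category.comp_id _).trans (Category.id_comp _).symm)
      ((Category.comp_id _).trans ((overlapSwap_ι α β).trans (Category.id_comp _).symm))
      ((Category.comp_id _).trans (Category.id_comp _).symm)
      ((Category.comp_id _).trans (Category.id_comp _).symm)

end Gluing

/-! ### Morphisms to a gluing of the charts -/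

namespace IsGluing

variable {Ch : Over SpecF2.{u}} {ι : ∀ α : G, chart α ⟶ Ch} (H : IsGluing Ch ι)
  {X : Over SpecF2.{u}} {α β : G}

include H

/-- Two points of charts become equal in the gluing if and only if the coefficients are related. -/
lemma comp_eq_comp_iff (f : X ⟶ chart α) (g : X ⟶ chart β) :
    f ≫ ι α = g ≫ ι β ↔ (coeffOf f).Rebase (coeffOf g) := by
  rw [← coeff_left, ← coeff_left]
  refine Iff.trans ?_ exists_overlap_lift_iff_rebase
  constructor
  · intro h
    have h' : f.left ≫ (ι α).left = g.left ≫ (ι β).left := congrArg (fun k => k.left) h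
    exact ⟨(H.overlap α β).lift _ _ h', (H.overlap α β).lift_fst _ _ h',
      (H.overlap α β).lift_snd _ _ h'⟩
  · rintro ⟨h, h1, h2⟩
    refine Over.OverMorphism.ext ?_
    rw [Over.comp_left, Over.comp_left, ← h1, ← h2]
    exact (Category.assoc _ _ _).trans ((congrArg (h ≫ ·) (H.overlap α β).w).trans
      (Category.assoc _ _ _).symm)

end IsGluing

/-! ### Frames and coefficients over rings -/

section Algebra

variable {R S ι : Type*} [CommRing R] [CommRing S]

lemma mul_self_of_trace_eq_zero (h2 : (2 : R) = 0) {M : M2 R} (h : M.trace = 0) :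
    M * M = M.det • (1 : M2 R) := by
  rw [Matrix.trace_fin_two] at h
  ext i j
  fin_cases i <;> fin_cases j <;> simp [Matrix.mul_apply, Fin.sum_univ_two, Matrix.det_fin_two]
  · linear_combination M 0 0 * h - (M 0 0 * M 1 1 - M 0 1 * M 1 0) * h2
  · linear_combination M 0 1 * h
  · linear_combination M 1 0 * h
  · linear_combination M 1 1 * h - (M 0 0 * M 1 1 - M 0 1 * M 1 0) * h2

lemma det_add_smul {M : M2 R} (h : M.trace = 0) (x y : R) :
    (x • (1 : M2 R) + y • M).det = x ^ 2 + y ^ 2 * M.det := by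
  rw [Matrix.trace_fin_two] at h
  simp [Matrix.det_fin_two]
  linear_combination x * y * h

/-- The coefficients of a representation that is spanned by `1` and the matrix of `α`. -/
lemma exists_coeff_of_basis (h2 : (2 : R) = 0) {α : G} (ρ : G →* M2 R)
    (htr : (ρ α).trace = 0)
    (hind : ∀ x y : R, x • (1 : M2 R) + y • ρ α = 0 → x = 0 ∧ y = 0)
    (hspan : ∀ g, ∃ x y : R, ρ g = x • (1 : M2 R) + y • ρ α) :
    ∃ c : ABCoeff G α R, ∀ g, c.d g = (ρ g).det ∧ ρ g = c.a g • (1 : M2 R) + c.b g • ρ α := by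
  choose a b hab using hspan
  have huniq : ∀ x y x' y' : R, x • (1 : M2 R) + y • ρ α = x' • (1 : M2 R) + y' • ρ α →
      x = x' ∧ y = y' := by
    intro x y x' y' h
    have := hind (x - x') (y - y') (by
      rw [← sub_eq_zero.2 h]; module)
    exact ⟨sub_eq_zero.1 this.1, sub_eq_zero.1 this.2⟩
  have h1 := huniq (a 1) (b 1) 1 0 (by rw [← hab, map_one]; simp)
  have hα := huniq (a α) (b α) 0 1 (by rw [← hab]; simp)
  have hmul : ∀ g h, a (g * h) = a g * a h + b g * b h * (ρ α).det ∧
      b (g * h) = a g * b h + b g * a h := by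
    intro g h
    refine huniq _ _ _ _ ?_
    rw [← hab, map_mul]
    conv_lhs => rw [hab g, hab h]
    rw [add_mul, mul_add, mul_add, smul_mul_smul_comm, smul_mul_smul_comm, smul_mul_smul_comm,
      smul_mul_smul_comm, mul_self_of_trace_eq_zero h2 htr, one_mul, one_mul, mul_one]
    module
  refine ⟨{ d := (Matrix.detMonoidHom).comp ρ, a := a, b := b, a_one := h1.1, b_one := h1.2,
            a_base := hα.1, b_base := hα.2, a_mul := fun g h => (hmul g h).1,
            b_mul := fun g h => (hmul g h).2, norm := fun g => ?_ }, fun g => ⟨rfl, hab g⟩⟩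
  change a g ^ 2 + b g ^ 2 * (ρ α).det = (ρ g).det
  rw [← det_add_smul htr, ← hab]

lemma Frame.trace_eq_zero {σ : ι → M2 R} {r : ℕ} {Z : Fin 2 → M2 R} {e : Fin r → M2 R}
    (F : Frame σ r Z e) (i : ι) : (σ i).trace = 0 := by
  obtain ⟨c, hc⟩ := F.gen i
  rw [hc, Matrix.trace_sum]
  exact Finset.sum_eq_zero fun k _ => by rw [Matrix.trace_smul, F.trace, smul_zero]

/-- If the matrices `σ i` lie in the span of `1` and `M = σ k`, then `1` and `M` are linearly
independent: they generate a free module of rank `2`. -/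
lemma Frame.linearIndependent {σ : ι → M2 R} {r : ℕ} {Z : Fin 2 → M2 R} {e : Fin r → M2 R}
    (F : Frame σ r Z e) (h2 : (2 : R) = 0) {k : ι}
    (hspan : ∀ i, ∃ x y : R, σ i = x • (1 : M2 R) + y • σ k) {x y : R}
    (h : x • (1 : M2 R) + y • σ k = 0) : x = 0 ∧ y = 0 := by
  obtain ⟨p, hp⟩ := F.one
  obtain ⟨q, hq⟩ := F.gen k
  have hmem : ∀ M ∈ Algebra.adjoin R (Set.range σ), ∃ x y : R, M = x • (1 : M2 R) + y • σ k := by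
    intro M hM
    induction hM using Algebra.adjoin_induction with
    | mem M hM => obtain ⟨i, rfl⟩ := hM; exact hspan i
    | algebraMap r => exact ⟨r, 0, by rw [Algebra.algebraMap_eq_smul_one, zero_smul, add_zero]⟩
    | add M N _ _ hM hN =>
      obtain ⟨x, y, rfl⟩ := hM
      obtain ⟨z, w, rfl⟩ := hN
      exact ⟨x + z, y + w, by module⟩
    | mul M N _ _ hM hN =>
      obtain ⟨x, y, rfl⟩ := hM
      obtain ⟨z, w, rfl⟩ := hN
      refine ⟨x * z + y * w * (σ k).det, x * w + y * z, ?_⟩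
      rw [add_mul, mul_add, mul_add, smul_mul_smul_comm, smul_mul_smul_comm, smul_mul_smul_comm,
        smul_mul_smul_comm, mul_self_of_trace_eq_zero h2 (F.trace_eq_zero k), one_mul, one_mul,
        mul_one]
      module
  choose n m hnm using fun l => hmem (Z l) (F.mem l)
  -- The matrices of coordinates of `(Z 0, Z 1)` in `(1, σ k)` and conversely are inverse.
  have hNQ : (!![n 0, m 0; n 1, m 1] : M2 R) * !![p 0, p 1; q 0, q 1] = 1 := by
    have key : ∀ l, (fun t => n l * p t + m l * q t) = Pi.single l (1 : R) := by
      intro l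
      refine (F.unique (d := 0) (d' := 0) ?_).1
      have hs : ∑ t, (Pi.single l (1 : R) : Fin 2 → R) t • Z t = Z l := by
        fin_cases l <;> simp
      rw [hs]
      conv_rhs => rw [hnm l, hp, hq]
      simp only [Fin.sum_univ_two]
      simp
      module
    ext i j
    have := congrFun (key i) j
    fin_cases i <;> fin_cases j <;> simpa [Matrix.mul_apply, Fin.sum_univ_two] using this
  have hQN := mul_eq_one_comm.1 hNQ
  have hz : (fun t => x * p t + y * q t) = 0 := by
    refine (F.unique (d := 0) (d' := 0) ?_).1
    have : ∑ t, (x * p t + y * q t) • Z t = 0 := by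
      rw [← h, hp, hq]
      simp only [Fin.sum_univ_two]
      module
    rw [this]
    simp
  have h0 := congrFun hz 0
  have h1 := congrFun hz 1
  have e00 := congrFun (congrFun hQN 0) 0
  have e01 := congrFun (congrFun hQN 0) 1
  have e10 := congrFun (congrFun hQN 1) 0
  have e11 := congrFun (congrFun hQN 1) 1
  simp [Matrix.mul_apply, Fin.sum_univ_two] at h0 h1 e00 e01 e10 e11
  constructor
  · linear_combination n 0 * h0 + n 1 * h1 - x * e00 - y * e10
  · linear_combination m 0 * h0 + m 1 * h1 - x * e01 - y * e11

/-- Over a field, an algebra of rank `2` is not generated by scalar matrices. -/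
lemma Frame.exists_not_scalar {K : Type*} [Field K] {σ : ι → M2 K} {r : ℕ} {Z : Fin 2 → M2 K}
    {e : Fin r → M2 K} (F : Frame σ r Z e) : ∃ i, ∀ x : K, σ i ≠ x • (1 : M2 K) := by
  by_contra! H
  have hmem : ∀ M ∈ Algebra.adjoin K (Set.range σ), ∃ x : K, M = x • (1 : M2 K) := by
    intro M hM
    induction hM using Algebra.adjoin_induction with
    | mem M hM => obtain ⟨i, rfl⟩ := hM; exact H i
    | algebraMap r => exact ⟨r, Algebra.algebraMap_eq_smul_one _⟩
    | add M N _ _ hM hN =>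
      obtain ⟨x, rfl⟩ := hM
      obtain ⟨y, rfl⟩ := hN
      exact ⟨x + y, by module⟩
    | mul M N _ _ hM hN =>
      obtain ⟨x, rfl⟩ := hM
      obtain ⟨y, rfl⟩ := hN
      exact ⟨x * y, by rw [smul_mul_smul_comm, one_mul]⟩
  obtain ⟨x, hx⟩ := hmem _ (F.mem 0)
  obtain ⟨y, hy⟩ := hmem _ (F.mem 1)
  have h1 := (F.unique (c := ![y, -x]) (c' := 0) (d := 0) (d' := 0) (by
    simp [Fin.sum_univ_two, hx, hy]; module)).1
  have hx0 : x = 0 := by simpa using congrFun h1 1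
  have h2 := (F.unique (c := ![1, 0]) (c' := 0) (d := 0) (d' := 0) (by
    simp [Fin.sum_univ_two, hx, hx0])).1
  simpa using congrFun h2 0

/-- Over a field, `1` and some `σ i` form a basis of the span of `Z`: the determinant of their
coordinates with respect to `Z` is nonzero. -/
lemma Frame.exists_det_ne_zero {K : Type*} [Field K] {σ : ι → M2 K} {r : ℕ} {Z : Fin 2 → M2 K}
    {e : Fin r → M2 K} (F : Frame σ r Z e) (p : Fin 2 → K) (hp : (1 : M2 K) = ∑ k, p k • Z k)
    (q : ι → Fin 2 → K) (hq : ∀ i, σ i = ∑ k, q i k • Z k) :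
    ∃ i, p 0 * q i 1 - p 1 * q i 0 ≠ 0 := by
  obtain ⟨i, hi⟩ := F.exists_not_scalar
  refine ⟨i, fun h => ?_⟩
  have hp0 : p 0 ≠ 0 ∨ p 1 ≠ 0 := by
    by_contra! h0
    refine one_ne_zero (α := M2 K) ?_
    rw [hp, Fin.sum_univ_two, h0.1, h0.2, zero_smul, zero_smul, add_zero]
  rcases hp0 with h0 | h0
  · refine hi (q i 0 / p 0) ?_
    have : q i 1 = q i 0 / p 0 * p 1 := by field_simp; linear_combination h
    rw [hq, hp, Fin.sum_univ_two, Fin.sum_univ_two, smul_add, smul_smul, smul_smul, ← this,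
      div_mul_cancel₀ _ h0]
  · refine hi (q i 1 / p 1) ?_
    have : q i 0 = q i 1 / p 1 * p 0 := by field_simp; linear_combination -h
    rw [hq, hp, Fin.sum_univ_two, Fin.sum_univ_two, smul_add, smul_smul, smul_smul, ← this,
      div_mul_cancel₀ _ h0]

/-- If `1` and the matrix of `α` span the same module as the frame, then coefficients with respect
to `α` exist. -/
lemma Frame.exists_coeff (h2 : (2 : R) = 0) {ρ : G →* M2 R} {r : ℕ} {Z : Fin 2 → M2 R}
    {e : Fin r → M2 R} (F : Frame ρ r Z e) {α : G} {p q : Fin 2 → R}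
    (hp : (1 : M2 R) = ∑ k, p k • Z k) (hq : ρ α = ∑ k, q k • Z k)
    (hD : IsUnit (p 0 * q 1 - p 1 * q 0)) :
    ∃ c : ABCoeff G α R, ∀ g, c.d g = (ρ g).det ∧ ρ g = c.a g • (1 : M2 R) + c.b g • ρ α := by
  obtain ⟨w, hw⟩ := hD.exists_right_inv
  have hspan : ∀ g, ∃ x y : R, ρ g = x • (1 : M2 R) + y • ρ α := by
    intro g
    obtain ⟨s, hs⟩ := F.gen g
    refine ⟨(s 0 * q 1 - s 1 * q 0) * w, (p 0 * s 1 - p 1 * s 0) * w, ?_⟩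
    rw [hs, hp, hq]
    simp only [Fin.sum_univ_two, smul_add, smul_smul]
    rw [add_add_add_comm, ← add_smul, ← add_smul]
    congr 2
    · linear_combination -s 0 * hw
    · linear_combination -s 1 * hw
  exact exists_coeff_of_basis h2 ρ (F.trace_eq_zero α)
    (fun x y h => F.linearIndependent h2 hspan h) hspan

/-- The determinant of `(v, M v)` for a vector `v` with integral entries. -/
def cyclicDet (M : M2 R) (v : ℕ × ℕ) : R :=
  v.1 * (M 1 0 * v.1 + M 1 1 * v.2) - v.2 * (M 0 0 * v.1 + M 0 1 * v.2)

lemma map_cyclicDet (φ : R →+* S) (M : M2 R) (v : ℕ × ℕ) :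
    φ (cyclicDet M v) = cyclicDet (φ.mapMatrix M) v := by
  simp [cyclicDet]

/-- A matrix that is not scalar has a cyclic vector among `(1, 0)`, `(0, 1)` and `(1, 1)`. -/
lemma exists_cyclicDet_ne_zero {M : M2 R} (h : ∀ x : R, M ≠ x • (1 : M2 R)) :
    ∃ v, cyclicDet M v ≠ 0 := by
  by_contra! H
  have h1 := H (1, 0)
  have h2 := H (0, 1)
  have h3 := H (1, 1)
  simp [cyclicDet] at h1 h2 h3
  refine h (M 0 0) ?_
  ext i j
  fin_cases i <;> fin_cases j <;> simp [h1, h2]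
  rw [h1, h2] at h3
  linear_combination h3

/-- Conjugation by an invertible matrix, as an automorphism of the matrix algebra. -/
def conjEquiv (P P' : M2 R) (h : P * P' = 1) : M2 R ≃ₐ[R] M2 R where
  toFun N := P' * N * P
  invFun N := P * N * P'
  left_inv N := by
    have : P * (P' * N * P) * P' = P * P' * N * (P * P') := by simp only [mul_assoc]
    exact this.trans (by rw [h, one_mul, mul_one])
  right_inv N := by
    have : P' * (P * N * P') * P = P' * P * N * (P' * P) := by simp only [mul_assoc]
    exact this.trans (by rw [mul_eq_one_comm.1 h, one_mul, mul_one])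
  map_mul' M N := by
    have : P' * M * P * (P' * N * P) = P' * M * (P * P') * N * P := by simp only [mul_assoc]
    rw [this, h, mul_one]
    simp only [mul_assoc]
  map_add' M N := by rw [mul_add, add_mul]
  commutes' r := by
    rw [Algebra.algebraMap_eq_smul_one, mul_smul_comm, smul_mul_assoc, mul_one,
      mul_eq_one_comm.1 h]

/-- A matrix of trace zero with a cyclic vector is conjugate to a companion matrix. -/
lemma exists_conj_companion (h2 : (2 : R) = 0) {M : M2 R} (htr : M.trace = 0) {v : ℕ × ℕ}
    (hv : IsUnit (cyclicDet M v)) :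
    ∃ τ : M2 R ≃ₐ[R] M2 R, τ M = ABCoeff.companion M.det := by
  obtain ⟨w, hw⟩ := hv.exists_right_inv
  let P : M2 R := !![(v.1 : R), M 0 0 * v.1 + M 0 1 * v.2; (v.2 : R), M 1 0 * v.1 + M 1 1 * v.2]
  have hdet : P.det = cyclicDet M v := by
    simp [P, Matrix.det_fin_two, cyclicDet]
    ring
  have hP : P * (w • P.adjugate) = 1 := by
    rw [mul_smul_comm, Matrix.mul_adjugate, smul_smul, hdet, mul_comm, hw, one_smul]
  refine ⟨conjEquiv P _ hP, ?_⟩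
  have hMP : M * P = P * ABCoeff.companion M.det := by
    rw [Matrix.trace_fin_two] at htr
    ext i j
    fin_cases i <;> fin_cases j <;>
      simp [P, ABCoeff.companion, Matrix.mul_apply, Fin.sum_univ_two, Matrix.det_fin_two]
    · linear_combination (M 0 0 * v.1 + M 0 1 * v.2) * htr
        - v.1 * (M 0 0 * M 1 1 - M 0 1 * M 1 0) * h2
    · linear_combination (M 1 0 * v.1 + M 1 1 * v.2) * htr
        - v.2 * (M 0 0 * M 1 1 - M 0 1 * M 1 0) * h2
  change (w • P.adjugate) * M * P = _
  rw [mul_assoc, hMP, ← mul_assoc, mul_eq_one_comm.1 hP, one_mul]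

end Algebra

/-! ### Local structure of representations with unipotent mold -/

section Local

variable {X Y : Scheme.{u}}

lemma Rep.pullback_comp {Z : Scheme.{u}} (g : Z ⟶ Y) (f : Y ⟶ X) (ρ : Rep G X) :
    ρ.pullback (g ≫ f) = (ρ.pullback f).pullback g := by
  ext x i j
  exact congrArg (fun φ => φ.hom (ρ x i j)) (Scheme.Hom.comp_appTop g f)

lemma Rep.pullback_id (ρ : Rep G X) : ρ.pullback (𝟙 X) = ρ := by
  ext x i j
  exact congrArg (fun φ : Γ(X, ⊤) ⟶ Γ(X, ⊤) => φ.hom (ρ x i j)) (Scheme.Hom.id_appTop (X := X))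

lemma ι_appTop_eq (U : X.Opens) (a : Γ(X, ⊤)) :
    U.ι.appTop.hom a = U.topIso.inv.hom (res (le_top : U ≤ ⊤) a) := by
  have : U.ι.appTop = X.presheaf.map (homOfLE (le_top : U ≤ ⊤)).op ≫ U.topIso.inv := by
    exact X.presheaf.map_comp (homOfLE (le_top : U ≤ ⊤)).op (eqToHom U.ι_image_top).op
  rw [this]; rfl

/-- Near each point, a representation with unipotent mold has a frame. -/
lemma Rep.IsUnipotentF2.exists_frame {ρ : Rep G X} (H : ρ.IsUnipotentF2) (x : X) :
    ∃ U : X.Opens, x ∈ U ∧ ∃ (r : ℕ) (Z : Fin 2 → M2 Γ(U, ⊤)) (e : Fin r → M2 Γ(U, ⊤)),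
      Frame (ρ.pullback U.ι) r Z e := by
  obtain ⟨U, hx, r, Z, e, F⟩ := H.hasFrames x
  refine ⟨U, hx, r, fun k => U.topIso.inv.hom.mapMatrix (Z k),
    fun k => U.topIso.inv.hom.mapMatrix (e k), ?_⟩
  convert F.map U.topIso.inv.hom using 2 with g
  ext i j
  exact ι_appTop_eq U _

/-- A function that does not vanish at a point is invertible near that point. -/
lemma exists_isUnit_appTop {s : Γ(X, ⊤)} {x : X} (h : X.evaluation ⊤ x trivial s ≠ 0) :
    ∃ U : X.Opens, x ∈ U ∧ IsUnit (U.ι.appTop.hom s) := by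
  refine ⟨X.basicOpen s, (X.evaluation_ne_zero_iff_mem_basicOpen (U := ⊤) x trivial s).1 h, ?_⟩
  rw [ι_appTop_eq]
  exact (RingedSpace.isUnit_res_basicOpen _ s).map _

/-- The value of a frame at a point. -/
lemma Frame.evaluation {ρ : Rep G X} {r : ℕ} {Z : Fin 2 → M2 Γ(X, ⊤)} {e : Fin r → M2 Γ(X, ⊤)}
    (F : Frame ρ r Z e) (x : X) :
    Frame (fun g => (X.evaluation ⊤ x trivial).hom.mapMatrix (ρ g)) r
      (fun k => (X.evaluation ⊤ x trivial).hom.mapMatrix (Z k))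
      (fun k => (X.evaluation ⊤ x trivial).hom.mapMatrix (e k)) :=
  F.map _

lemma ABCoeff.IsOf.pullback {α : G} {c : ABCoeff G α Γ(X, ⊤)} {ρ : Rep G X} (h : c.IsOf ρ)
    (f : Y ⟶ X) : (c.map f.appTop.hom).IsOf (ρ.pullback f) := by
  intro g
  refine ⟨?_, ?_⟩
  · rw [Rep.pullback_apply, ← RingHom.map_det, ← (h g).1]; rfl
  · rw [Rep.pullback_apply, Rep.pullback_apply]
    conv_lhs => rw [(h g).2]
    ext i j
    fin_cases i <;> fin_cases j <;> simp [ABCoeff.map]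

/-- Near each point, a representation with unipotent mold has coefficients: at the residue
field the algebra has rank `2`, so that some matrix `ρ(α)` is not scalar there. -/
lemma Rep.IsUnipotentF2.exists_coeff (h2 : (2 : Γ(X, ⊤)) = 0) {ρ : Rep G X}
    (H : ρ.IsUnipotentF2) (x : X) :
    ∃ (Y : Scheme.{u}) (j : Y ⟶ X), IsOpenImmersion j ∧ x ∈ Set.range j ∧
      ∃ (α : G) (c : ABCoeff G α Γ(Y, ⊤)), c.IsOf (ρ.pullback j) := by
  obtain ⟨U, hx, r, Z, e, F⟩ := H.exists_frame x
  obtain ⟨p, hp⟩ := F.one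
  choose q hq using F.gen
  let y : U.toScheme := ⟨x, hx⟩
  let φ := (U.toScheme.evaluation ⊤ y trivial).hom
  obtain ⟨α, hα⟩ := (F.evaluation y).exists_det_ne_zero (fun k => φ (p k))
    (by rw [← mapMatrix_sum_smul, ← hp, map_one]) (fun g k => φ (q g k))
    (fun g => by rw [hq g, mapMatrix_sum_smul])
  obtain ⟨V, hV, hs⟩ := exists_isUnit_appTop (X := U) (x := y) (s := p 0 * q α 1 - p 1 * q α 0) (by
    change φ _ ≠ 0
    rwa [map_sub, map_mul, map_mul])
  refine ⟨V, V.ι ≫ U.ι, inferInstance, ⟨⟨y, hV⟩, rfl⟩, α, ?_⟩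
  rw [Rep.pullback_comp]
  have h2' : (2 : Γ(V, ⊤)) = 0 := by
    have := congrArg (V.ι ≫ U.ι).appTop.hom h2
    rwa [map_ofNat, map_zero] at this
  refine (F.map V.ι.appTop.hom).exists_coeff h2' (ρ := (ρ.pullback U.ι).pullback V.ι)
    (p := fun k => V.ι.appTop.hom (p k)) (q := fun k => V.ι.appTop.hom (q α k)) ?_ ?_ ?_
  · rw [← mapMatrix_sum_smul, ← hp, map_one]
  · rw [← mapMatrix_sum_smul, ← hq]; rfl
  · rwa [map_sub, map_mul, map_mul] at hs

lemma Rep.IsUnipotentF2.trace_eq_zero {ρ : Rep G X} (H : ρ.IsUnipotentF2) (g : G) :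
    (ρ g).trace = 0 := by
  refine H.2.2 ⊤ _ (mem_generated_of_mem_adjoin ρ (Algebra.subset_adjoin ⟨g, ?_⟩))
  ext i j
  exact res_self _ _

lemma eq_zero_of_locally {a : Γ(X, ⊤)}
    (h : ∀ x : X, ∃ U : X.Opens, x ∈ U ∧ U.ι.appTop.hom a = 0) : a = 0 := by
  refine eq_of_locally _ _ fun x _ => ?_
  obtain ⟨U, hx, hU⟩ := h x
  refine ⟨U, le_top, hx, ?_⟩
  rw [ι_appTop_eq] at hU
  rw [map_zero]
  have := congrArg U.topIso.hom.hom hU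
  rw [map_zero] at this
  rw [← this]
  exact congrArg (fun φ => φ.hom (UnipotentModuli.res (le_top : U ≤ ⊤) a)) U.topIso.inv_hom_id.symm

variable {α β : G}

/-- If a representation with unipotent mold has coefficients with respect to `α`, then `1` and
`ρ(α)` are linearly independent, since they are so locally. -/
lemma ABCoeff.IsOf.linearIndependent (h2 : (2 : Γ(X, ⊤)) = 0) {ρ : Rep G X}
    (H : ρ.IsUnipotentF2) {c : ABCoeff G α Γ(X, ⊤)} (hc : c.IsOf ρ) {x y : Γ(X, ⊤)}
    (h : x • (1 : M2 Γ(X, ⊤)) + y • ρ α = 0) : x = 0 ∧ y = 0 := by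
  have key : ∀ z : X, ∃ U : X.Opens, z ∈ U ∧ U.ι.appTop.hom x = 0 ∧ U.ι.appTop.hom y = 0 := by
    intro z
    obtain ⟨U, hz, r, Z, e, F⟩ := H.exists_frame z
    refine ⟨U, hz, F.linearIndependent (k := α) ?_ ?_ ?_⟩
    · have := congrArg U.ι.appTop.hom h2
      rwa [map_ofNat, map_zero] at this
    · exact fun g => ⟨_, _, ((hc.pullback U.ι) g).2⟩
    · have := congrArg U.ι.appTop.hom.mapMatrix h
      rw [map_zero] at this
      rw [← this, Rep.pullback_apply]
      ext i j
      fin_cases i <;> fin_cases j <;> simp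
  exact ⟨eq_zero_of_locally fun z => (key z).imp fun U hU => ⟨hU.1, hU.2.1⟩,
    eq_zero_of_locally fun z => (key z).imp fun U hU => ⟨hU.1, hU.2.2⟩⟩

/-- The coefficients of a representation with unipotent mold with respect to two base elements
are related by the change of the base element. -/
lemma ABCoeff.IsOf.rebase (h2 : (2 : Γ(X, ⊤)) = 0) {ρ : Rep G X} (H : ρ.IsUnipotentF2)
    {c : ABCoeff G α Γ(X, ⊤)} (hc : c.IsOf ρ) {c' : ABCoeff G β Γ(X, ⊤)} (hc' : c'.IsOf ρ) :
    c.Rebase c' := by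
  have huniq : ∀ x y x' y' : Γ(X, ⊤), x • (1 : M2 Γ(X, ⊤)) + y • ρ α = x' • 1 + y' • ρ α →
      x = x' ∧ y = y' := by
    intro x y x' y' h
    have := hc.linearIndependent h2 H (x := x - x') (y := y - y') (by
      rw [← sub_eq_zero.2 h]; module)
    exact ⟨sub_eq_zero.1 this.1, sub_eq_zero.1 this.2⟩
  -- Express each matrix first in terms of `ρ β` and then of `ρ α`.
  have key : ∀ g, c.a g = c'.a g + c'.b g * c.a β ∧ c.b g = c'.b g * c.b β := by
    intro g
    refine huniq _ _ _ _ ?_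
    rw [← (hc g).2]
    conv_lhs => rw [(hc' g).2, (hc β).2]
    module
  -- For `g = α`, the second relation shows that `c.b β` is invertible.
  have hu : c.b β * c'.b α = 1 := by rw [mul_comm, ← (key α).2, c.b_base]
  refine ⟨MonoidHom.ext fun g => (hc' g).1.trans (hc g).1.symm, c'.b α, hu, fun g => ?_,
    fun g => ?_⟩
  · rw [(key g).1, (key g).2]
    linear_combination -c'.b g * c.a β * hu - c'.b g * c.a β * h2
  · rw [(key g).2]
    linear_combination -c'.b g * hu

/-- Equivalent representations have the same coefficients. The determinants agree since
`ρ(g)² = det ρ(g)` for matrices of trace zero in characteristic two. -/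
lemma ABCoeff.IsOf.of_equivalent (h2 : (2 : Γ(X, ⊤)) = 0) {ρ ρ' : Rep G X}
    (H : ρ.IsUnipotentF2) (H' : ρ'.IsUnipotentF2) (h : ρ.Equivalent ρ')
    {c : ABCoeff G α Γ(X, ⊤)} (hc : c.IsOf ρ) : c.IsOf ρ' := by
  obtain ⟨σ, hσ⟩ := h
  intro g
  constructor
  · have h1 := congrArg σ (mul_self_of_trace_eq_zero h2 (H.trace_eq_zero g))
    rw [map_mul, hσ, map_smul, map_one, mul_self_of_trace_eq_zero h2 (H'.trace_eq_zero g),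
      ← (hc g).1] at h1
    simpa using (congrFun (congrFun h1 0) 0).symm
  · have h1 := congrArg σ (hc g).2
    rwa [hσ, map_add, map_smul, map_smul, map_one, hσ] at h1

lemma isOf_toRep (h2 : (2 : Γ(X, ⊤)) = 0) (c : ABCoeff G α Γ(X, ⊤)) :
    c.IsOf (X := X) c.toRep := fun g =>
  ⟨(c.det_toRep h2 g).symm, by rw [c.toRep_base]; rfl⟩

lemma pullback_toRep (c : ABCoeff G α Γ(X, ⊤)) (f : Y ⟶ X) :
    Rep.pullback (X := X) f c.toRep = (c.map f.appTop.hom).toRep :=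
  MonoidHom.ext fun g => (c.toRep_map f.appTop.hom g).symm

lemma isUnipotentF2_toRep (h2 : (2 : Γ(X, ⊤)) = 0) (c : ABCoeff G α Γ(X, ⊤)) :
    Rep.IsUnipotentF2 (X := X) c.toRep := by
  refine Rep.HasFrames.isUnipotentF2 fun x => ⟨⊤, trivial, 2, ![1, ABCoeff.companion (c.d α)],
    ![!![1, 0; 0, 0], !![0, 1; 0, 0]], ?_⟩
  convert c.frame_toRep h2 using 2 with g
  ext i j
  exact res_self _ _

/-- A representation with unipotent mold is locally equivalent to the companion representation
of its coefficients. -/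
lemma ABCoeff.IsOf.exists_equivalent_toRep (h2 : (2 : Γ(X, ⊤)) = 0) {ρ : Rep G X}
    (H : ρ.IsUnipotentF2) {c : ABCoeff G α Γ(X, ⊤)} (hc : c.IsOf ρ) (x : X) :
    ∃ (Y : Scheme.{u}) (j : Y ⟶ X), IsOpenImmersion j ∧ x ∈ Set.range j ∧
      (ρ.pullback j).Equivalent (Rep.pullback (X := X) j c.toRep) := by
  obtain ⟨U, hx, r, Z, e, F⟩ := H.exists_frame x
  let y : U.toScheme := ⟨x, hx⟩
  let φ := (U.toScheme.evaluation ⊤ y trivial).hom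
  have hU := hc.pullback U.ι
  -- If `ρ(α)` were scalar at the point, all matrices `ρ(g)` would be.
  have hns : ∀ z : U.toScheme.residueField y, φ.mapMatrix (ρ.pullback U.ι α) ≠
      z • (1 : M2 (U.toScheme.residueField y)) := by
    intro z hz
    obtain ⟨g, hg⟩ := (F.evaluation y).exists_not_scalar
    refine hg (φ ((c.map U.ι.appTop.hom).a g) + φ ((c.map U.ι.appTop.hom).b g) * z) ?_
    change φ.mapMatrix (ρ.pullback U.ι g) = _
    rw [(hU g).2, add_smul, mul_smul, ← hz]
    ext i j
    fin_cases i <;> fin_cases j <;> simp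
  obtain ⟨v, hv⟩ := exists_cyclicDet_ne_zero hns
  rw [← map_cyclicDet] at hv
  obtain ⟨V, hV, hs⟩ := exists_isUnit_appTop (X := U) (x := y) hv
  refine ⟨V, V.ι ≫ U.ι, inferInstance, ⟨⟨y, hV⟩, rfl⟩, ?_⟩
  have h2' : (2 : Γ(V, ⊤)) = 0 := by
    have := congrArg (V.ι ≫ U.ι).appTop.hom h2
    rwa [map_ofNat, map_zero] at this
  have hVc := hc.pullback (V.ι ≫ U.ι)
  rw [map_cyclicDet] at hs
  obtain ⟨τ, hτ⟩ := exists_conj_companion h2' (M := ρ.pullback (V.ι ≫ U.ι) α)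
    ((H.pullback _).trace_eq_zero α) (v := v) (by rw [Rep.pullback_comp]; exact hs)
  refine ⟨τ, fun g => ?_⟩
  rw [pullback_toRep, (hVc g).2, map_add, map_smul, map_smul, map_one, hτ, ← (hVc α).1]
  rfl

end Local

/-! ### The moduli problem -/

/-- The Zariski topology on `𝔽₂`-schemes. -/
noncomputable abbrev zariskiF2 : GrothendieckTopology (Over SpecF2.{u}) :=
  Scheme.zariskiTopology.{u}.over SpecF2.{u}

/-- A sieve is covering if each point lies in the image of an open immersion in the sieve. -/
lemma mem_zariskiF2_of_forall {X : Over SpecF2.{u}} (S : Sieve X)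
    (h : ∀ x : X.left, ∃ (Y : Scheme.{u}) (j : Y ⟶ X.left), IsOpenImmersion j ∧
      x ∈ Set.range j ∧ S (Over.homMk j : Over.mk (j ≫ X.hom) ⟶ X)) : S ∈ zariskiF2 X := by
  rw [GrothendieckTopology.mem_over_iff]
  choose Y j hj hx hS using h
  let 𝒰 : X.left.OpenCover := Scheme.Cover.mkOfCovers X.left Y j (fun x => ⟨x, hx x⟩) hj
  refine GrothendieckTopology.superset_covering _ ?_ 𝒰.mem_grothendieckTopology
  rw [Sieve.ofArrows, Sieve.generate_le_iff]
  rintro _ _ ⟨x⟩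
  exact (Sieve.overEquiv_iff _ _).2 (hS x)

/-- The morphisms along which a representation acquires coefficients. -/
def coeffSieve {X : Over SpecF2.{u}} (ρ : Rep G X.left) : Sieve X where
  arrows Y j := ∃ (α : G) (g : Y ⟶ chart α), (coeffOf g).IsOf (ρ.pullback j.left)
  downward_closed := by
    rintro Y Z j ⟨α, g, hg⟩ k
    refine ⟨α, k ≫ g, ?_⟩
    rw [coeffOf_comp, Over.comp_left, Rep.pullback_comp]
    exact hg.pullback k.left

lemma coeffSieve_mem {X : Over SpecF2.{u}} {ρ : Rep G X.left} (H : ρ.IsUnipotentF2) :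
    coeffSieve ρ ∈ zariskiF2 X := by
  refine mem_zariskiF2_of_forall _ fun x => ?_
  obtain ⟨Y, j, hj, hx, α, c, hc⟩ := H.exists_coeff (two_eq_zero_global X) x
  obtain ⟨g, hg⟩ := (coeffOf_bijective α (Over.mk (j ≫ X.hom))).2 c
  exact ⟨Y, j, hj, hx, α, g, by rw [hg]; exact hc⟩

/-- Equality of two morphisms of `𝔽₂`-schemes can be checked on a covering sieve. -/
lemma hom_ext_of_mem {X Y : Over SpecF2.{u}} {S : Sieve X} (hS : S ∈ zariskiF2 X) {f g : X ⟶ Y}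
    (h : ∀ ⦃Z : Over SpecF2.{u}⦄ (j : Z ⟶ X), S j → j ≫ f = j ≫ g) : f = g :=
  (GrothendieckTopology.Subcanonical.isSheaf_of_isRepresentable (J := zariskiF2)
    (yoneda.obj Y) S hS).isSeparatedFor.ext fun _ j hj => h j hj

/-- The morphisms along which two representations become equivalent. -/
def equivalentSieve {X : Over SpecF2.{u}} (ρ ρ' : Rep G X.left) : Sieve X where
  arrows Y j := (ρ.pullback j.left).Equivalent (ρ'.pullback j.left)
  downward_closed := by
    intro Y Z j hj k
    rw [Over.comp_left, Rep.pullback_comp, Rep.pullback_comp]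
    exact hj.pullback k.left

/-- Representations with the same coefficients are locally equivalent, since both are locally
equivalent to the companion representation. -/
lemma equivalentSieve_mem_of_isOf {X : Over SpecF2.{u}} {ρ ρ' : Rep G X.left}
    (hρ : ρ.IsUnipotentF2) (hρ' : ρ'.IsUnipotentF2) {α : G} {c : ABCoeff G α Γ(X.left, ⊤)}
    (hc : c.IsOf ρ) (hc' : c.IsOf ρ') : equivalentSieve ρ ρ' ∈ zariskiF2 X := by
  have h2 := two_eq_zero_global X
  have key : ∀ {σ : Rep G X.left}, σ.IsUnipotentF2 → c.IsOf σ →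
      equivalentSieve (X := X) σ c.toRep ∈ zariskiF2 X := fun hσ h =>
    mem_zariskiF2_of_forall _ (h.exists_equivalent_toRep h2 hσ)
  refine GrothendieckTopology.superset_covering _ ?_
    (GrothendieckTopology.intersection_covering _ (key hρ hc) (key hρ' hc'))
  rintro Y j ⟨⟨σ, hσ⟩, ⟨τ, hτ⟩⟩
  exact ⟨σ.trans τ.symm, fun g => by
    rw [AlgEquiv.trans_apply, hσ, ← hτ, AlgEquiv.symm_apply_apply]⟩

/-- Coefficients related to those of a representation are again coefficients of it. -/
lemma ABCoeff.IsOf.of_rebase {X : Scheme.{u}} (h2 : (2 : Γ(X, ⊤)) = 0) {α β : G} {ρ : Rep G X}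
    {c : ABCoeff G α Γ(X, ⊤)} {c' : ABCoeff G β Γ(X, ⊤)} (hc : c.IsOf ρ) (h : c.Rebase c') :
    c'.IsOf ρ := by
  obtain ⟨hd, u, hu, ha, hb⟩ := h
  intro g
  refine ⟨by rw [hd, (hc g).1], ?_⟩
  rw [(hc β).2, (hc g).2, ha, hb]
  have h3 : c.a g = c.a g + c.a β * u * c.b g + c.b g * u * c.a β := by
    linear_combination -c.a β * u * c.b g * h2
  have h4 : c.b g = c.b g * u * c.b β := by linear_combination -c.b g * hu
  refine (congrArg₂ (fun s t => s • (1 : M2 Γ(X, ⊤)) + t • ρ α) h3 h4).trans ?_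
  module

lemma isSheaf_yoneda_uliftFunctor (Y : Over SpecF2.{u}) :
    Presheaf.IsSheaf zariskiF2 (yoneda.obj Y ⋙ uliftFunctor.{u + 1, u}) := by
  rw [isSheaf_iff_isSheaf_of_type, Presieve.isSheaf_comp_uliftFunctor_iff]
  exact GrothendieckTopology.Subcanonical.isSheaf_of_isRepresentable _

namespace IsGluing

variable {Ch : Over SpecF2.{u}} {ι : ∀ α : G, chart α ⟶ Ch} (H : IsGluing Ch ι)
  {X Y : Over SpecF2.{u}} {α β : G}

/-- The morphism `f` classifies the representation `ρ`: where `ρ` has coefficients, `f` is given by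
these coefficients. -/
def Classifies (ι : ∀ α : G, chart α ⟶ Ch) (ρ : Rep G X.left) (f : X ⟶ Ch) : Prop :=
  ∀ (Y : Over SpecF2.{u}) (j : Y ⟶ X) (α : G) (g : Y ⟶ chart α),
    (coeffOf g).IsOf (ρ.pullback j.left) → j ≫ f = g ≫ ι α

lemma Classifies.unique {ρ : Rep G X.left} (hρ : ρ.IsUnipotentF2) {f f' : X ⟶ Ch}
    (h : Classifies ι ρ f) (h' : Classifies ι ρ f') : f = f' :=
  hom_ext_of_mem (coeffSieve_mem hρ) fun Y j ⟨α, g, hg⟩ =>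
    (h Y j α g hg).trans (h' Y j α g hg).symm

lemma Classifies.pullback {ρ : Rep G X.left} {f : X ⟶ Ch} (h : Classifies ι ρ f) (k : Y ⟶ X) :
    Classifies ι (ρ.pullback k.left) (k ≫ f) := by
  intro Z j α g hg
  rw [← Category.assoc]
  refine h Z (j ≫ k) α g ?_
  rwa [Over.comp_left, Rep.pullback_comp]

lemma Classifies.of_equivalent {ρ ρ' : Rep G X.left} (hρ : ρ.IsUnipotentF2)
    (hρ' : ρ'.IsUnipotentF2) (e : ρ.Equivalent ρ') {f : X ⟶ Ch} (h : Classifies ι ρ f) :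
    Classifies ι ρ' f := fun Y j α g hg =>
  h Y j α g (hg.of_equivalent (two_eq_zero_global Y) (hρ'.pullback _) (hρ.pullback _)
    ((repSetoid G Y.left).symm (a := ⟨_, hρ.pullback j.left⟩) (b := ⟨_, hρ'.pullback j.left⟩)
      (e.pullback j.left)))

include H

lemma comp_eq_comp_of_isOf {ρ : Rep G X.left} (hρ : ρ.IsUnipotentF2) {f : X ⟶ chart α}
    {g : X ⟶ chart β} (hf : (coeffOf f).IsOf ρ) (hg : (coeffOf g).IsOf ρ) :
    f ≫ ι α = g ≫ ι β :=
  (H.comp_eq_comp_iff f g).2 (hf.rebase (two_eq_zero_global X) hρ hg)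

/-- The classifying morphism exists: locally it is given by coefficients, and the local morphisms
agree on overlaps, since coefficients for different base elements are related. -/
lemma exists_classifies {ρ : Rep G X.left} (hρ : ρ.IsUnipotentF2) :
    ∃ f : X ⟶ Ch, Classifies ι ρ f := by
  have hsheaf := GrothendieckTopology.Subcanonical.isSheaf_of_isRepresentable (J := zariskiF2)
    (yoneda.obj Ch) (coeffSieve ρ) (coeffSieve_mem hρ)
  choose α g hg using fun (Y : Over SpecF2.{u}) (j : Y ⟶ X) (h : coeffSieve ρ j) => h
  let x : Presieve.FamilyOfElements (yoneda.obj Ch) (coeffSieve ρ).arrows :=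
    fun Y j h => g Y j h ≫ ι (α Y j h)
  have hx : x.Compatible := by
    intro Y₁ Y₂ Z k₁ k₂ j₁ j₂ h₁ h₂ e
    change k₁ ≫ g Y₁ j₁ h₁ ≫ ι _ = k₂ ≫ g Y₂ j₂ h₂ ≫ ι _
    rw [← Category.assoc, ← Category.assoc]
    refine H.comp_eq_comp_of_isOf (hρ.pullback (k₁ ≫ j₁).left) ?_ ?_
    · rw [Over.comp_left, Rep.pullback_comp, coeffOf_comp]
      exact (hg Y₁ j₁ h₁).pullback k₁.left
    · rw [e, Over.comp_left, Rep.pullback_comp, coeffOf_comp]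
      exact (hg Y₂ j₂ h₂).pullback k₂.left
  refine ⟨hsheaf.amalgamate x hx, fun Y j β g' hg' => ?_⟩
  have hj : coeffSieve ρ j := ⟨β, g', hg'⟩
  exact (hsheaf.valid_glue hx j hj).trans
    (H.comp_eq_comp_of_isOf (hρ.pullback j.left) (hg Y j hj) hg')

/-- The morphism classifying an equivalence class of representations. -/
noncomputable def classify (c : RepClass G X.left) : X ⟶ Ch :=
  Quotient.lift (fun ρ : {ρ : Rep G X.left // ρ.IsUnipotentF2} => (H.exists_classifies ρ.2).choose)
    (fun ρ ρ' e => Classifies.unique (ι := ι) ρ'.2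
      ((H.exists_classifies ρ.2).choose_spec.of_equivalent ρ.2 ρ'.2 e)
      (H.exists_classifies ρ'.2).choose_spec) c

lemma classifies_classify {ρ : Rep G X.left} (hρ : ρ.IsUnipotentF2) :
    Classifies ι ρ (H.classify (ρ.toClass hρ)) :=
  (H.exists_classifies hρ).choose_spec

lemma classify_toClass_of_isOf {ρ : Rep G X.left} (hρ : ρ.IsUnipotentF2) {g : X ⟶ chart α}
    (hg : (coeffOf g).IsOf ρ) : H.classify (ρ.toClass hρ) = g ≫ ι α := by
  have := H.classifies_classify hρ X (𝟙 X) α g (by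
    rw [Over.id_left, Rep.pullback_id]; exact hg)
  rwa [Category.id_comp] at this

lemma classify_pullback (c : RepClass G X.left) (k : Y ⟶ X) :
    H.classify (RepClass.pullback k.left c) = k ≫ H.classify c := by
  induction c using Quotient.inductionOn with
  | _ ρ =>
    exact Classifies.unique (ρ.2.pullback k.left) (H.classifies_classify (ρ.2.pullback k.left))
      ((H.classifies_classify ρ.2).pullback k)

/-- The classifying morphisms, as a morphism of presheaves. -/
noncomputable def classifyHom :
    repClassFunctor G ⋙ uliftFunctor.{u + 1, u} ⟶ yoneda.obj Ch ⋙ uliftFunctor.{u + 1, u} where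
  app X := TypeCat.ofHom fun c => ULift.up (H.classify (X := X.unop) c.down)
  naturality X Y f := by
    ext c
    exact congrArg ULift.up (H.classify_pullback c.down f.unop)

/-- Representations with the same classifying morphism are locally equivalent: their coefficients
are related, and both are locally equivalent to a companion representation. -/
lemma equivalentSieve_mem {ρ ρ' : Rep G X.left} (hρ : ρ.IsUnipotentF2) (hρ' : ρ'.IsUnipotentF2)
    (h : H.classify (ρ.toClass hρ) = H.classify (ρ'.toClass hρ')) :
    equivalentSieve ρ ρ' ∈ zariskiF2 X := by
  refine GrothendieckTopology.transitive _ (GrothendieckTopology.intersection_covering _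
    (coeffSieve_mem hρ) (coeffSieve_mem hρ')) _ ?_
  rintro Y j ⟨⟨α, f, hf⟩, ⟨β, g, hg⟩⟩
  have e := (H.comp_eq_comp_iff f g).1 ((H.classifies_classify hρ Y j α f hf).symm.trans
    ((congrArg (j ≫ ·) h).trans (H.classifies_classify hρ' Y j β g hg)))
  have h2 := two_eq_zero_global Y
  refine GrothendieckTopology.superset_covering _ ?_
    (equivalentSieve_mem_of_isOf (hρ.pullback j.left) (hρ'.pullback j.left) hf
      (hg.of_rebase h2 (e.symm h2)))
  intro Z k hk
  change Rep.Equivalent _ _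
  rw [Over.comp_left, Rep.pullback_comp, Rep.pullback_comp]
  exact hk

instance isLocallyInjective_classifyHom :
    Presheaf.IsLocallyInjective zariskiF2 H.classifyHom where
  equalizerSieve_mem := by
    rintro ⟨X⟩ ⟨c⟩ ⟨c'⟩ h
    induction c using Quotient.inductionOn with
    | _ ρ =>
    induction c' using Quotient.inductionOn with
    | _ ρ' =>
      refine GrothendieckTopology.superset_covering _ ?_
        (H.equivalentSieve_mem ρ.2 ρ'.2 (congrArg ULift.down h))
      intro Y j hj
      exact congrArg ULift.up (Quotient.sound (s := repSetoid G Y.left) hj)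

/-- Each morphism to the gluing factors locally through a chart, and then classifies a companion
representation. -/
instance isLocallySurjective_classifyHom :
    Presheaf.IsLocallySurjective zariskiF2 H.classifyHom where
  imageSieve_mem := by
    rintro X ⟨s⟩
    refine mem_zariskiF2_of_forall _ fun x => ?_
    obtain ⟨α, y, hy⟩ := H.cover (s.left x)
    have := H.isOpenImmersion α
    let j := Limits.pullback.snd (ι α).left s.left
    obtain ⟨z, -, hz⟩ := Scheme.Pullback.exists_preimage_pullback y x hy
    refine ⟨_, j, inferInstance, ⟨z, hz⟩, ?_⟩
    let g : Over.mk (j ≫ X.hom) ⟶ chart α := homMkF2 (Limits.pullback.fst (ι α).left s.left)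
    have h2 := two_eq_zero_global (Over.mk (j ≫ X.hom))
    refine ⟨ULift.up (Rep.toClass (X := (Over.mk (j ≫ X.hom)).left) (coeffOf g).toRep
      (isUnipotentF2_toRep h2 _)), congrArg ULift.up ?_⟩
    refine (H.classify_toClass_of_isOf _ (isOf_toRep h2 (coeffOf g))).trans ?_
    exact Over.OverMorphism.ext Limits.pullback.condition

/-- The classifying morphisms identify the sheafification with the functor of points. -/
lemma isIso_sheafifyLift :
    IsIso (sheafifyLift zariskiF2 H.classifyHom (isSheaf_yoneda_uliftFunctor Ch)) := by
  have hW :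
      zariskiF2.W (sheafifyLift zariskiF2 H.classifyHom (isSheaf_yoneda_uliftFunctor Ch)) := by
    refine MorphismProperty.of_precomp zariskiF2.W _ _
      (zariskiF2.W_toSheafify (repClassFunctor G ⋙ uliftFunctor.{u + 1, u})) ?_
    rw [toSheafify_sheafifyLift]
    exact zariskiF2.W_of_isLocallyBijective _
  let f : (presheafToSheaf zariskiF2 (Type (u + 1))).obj
      (repClassFunctor G ⋙ uliftFunctor.{u + 1, u}) ⟶ ⟨_, isSheaf_yoneda_uliftFunctor Ch⟩ :=
    ⟨sheafifyLift zariskiF2 H.classifyHom (isSheaf_yoneda_uliftFunctor Ch)⟩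
  have : IsIso f := (zariskiF2.W_sheafToPresheaf_map_iff_isIso f).1 hW
  exact inferInstanceAs (IsIso ((sheafToPresheaf _ _).map f))

/-- A gluing of the charts represents the moduli functor. -/
lemma exists_representableBy : ∃ r : (eqU2F2 G).RepresentableBy Ch,
    ∀ (X : Over SpecF2.{u}) (ρ : Rep G X.left) (hρ : ρ.IsUnipotentF2) (α : G) (f : X ⟶ chart α),
      (coeffOf f).IsOf ρ → r.homEquiv (f ≫ ι α) = eqU2F2.mk ρ hρ := by
  have := H.isIso_sheafifyLift
  let e : sheafify zariskiF2 (repClassFunctor G ⋙ uliftFunctor.{u + 1, u}) ≅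
      yoneda.obj Ch ⋙ uliftFunctor.{u + 1, u} :=
    asIso (sheafifyLift zariskiF2 H.classifyHom (isSheaf_yoneda_uliftFunctor Ch))
  refine ⟨{ homEquiv := fun {X} => Equiv.ulift.symm.trans (e.app (op X)).toEquiv.symm
            homEquiv_comp := fun {X X'} f g => ?_ }, fun X ρ hρ α f hf => ?_⟩
  · exact congrArg (fun φ => φ (ULift.up g)) (e.inv.naturality f.op)
  · change e.inv.app (op X) (ULift.up (f ≫ ι α)) = _
    have h1 : ULift.up (f ≫ ι α) = e.hom.app (op X) (eqU2F2.mk ρ hρ) := by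
      have h2 := congrArg (fun φ => φ.app (op X) (ULift.up (ρ.toClass hρ)))
        (toSheafify_sheafifyLift zariskiF2 H.classifyHom (isSheaf_yoneda_uliftFunctor Ch))
      exact (congrArg ULift.up (H.classify_toClass_of_isOf hρ hf).symm).trans h2.symm
    rw [h1]
    exact congrArg (fun φ => φ.app (op X) (eqU2F2.mk ρ hρ)) e.hom_inv_id

end IsGluing

/-! ### Separatedness -/

section Separated

variable {α β : G}

variable (α β) in
/-- The functions on the overlap are generated by the functions on the two charts: the inverse
of `b_α(β)` is `b_β(α)`. -/
lemma exists_overlap_mul (z : overlapRing α β) :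
    ∃ (x : A2 α) (y : A2 β), z = algebraMap (A2 α) (overlapRing α β) x * transition α β y := by
  obtain ⟨n, x, hx⟩ := IsLocalization.Away.surj ((univCoeff α).b β) z
  have h : algebraMap (A2 α) (overlapRing α β) ((univCoeff α).b β) *
    transition α β ((univCoeff β).b α) = 1 := (rebase_transition α β).b_mul_b
  refine ⟨x, (univCoeff β).b α ^ n, ?_⟩
  rw [← hx, map_pow, mul_assoc, ← mul_pow, h, one_pow, mul_one]

/-- A morphism from the overlap to an affine scheme that factors both projections, such as the
embedding into the product of the two charts, is surjective on functions. -/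
lemma isClosedImmersion_of_overlap {Y : Scheme.{u}} [IsAffine Y] {p : Y ⟶ chartScheme α}
    {q : Y ⟶ chartScheme β} (m : overlapScheme α β ⟶ Y) (hp : m ≫ p = overlapι α β)
    (hq : m ≫ q = overlapTr α β) : IsClosedImmersion m := by
  refine IsClosedImmersion.of_surjective_of_isAffine m fun z => ?_
  obtain ⟨w, rfl⟩ : ∃ w : overlapRing α β, globalHom (𝟙 (overlapScheme α β)) w = z := by
    refine ⟨(Scheme.ΓSpecIso (CommRingCat.of (overlapRing α β))).hom z, ?_⟩
    rw [globalHom, Scheme.Hom.id_appTop, Category.comp_id]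
    exact congrArg (fun φ => φ.hom z)
      (Scheme.ΓSpecIso (CommRingCat.of (overlapRing α β))).hom_inv_id
  obtain ⟨x, y, rfl⟩ := exists_overlap_mul α β w
  have h1 := globalHom_comp_specMap (𝟙 (overlapScheme α β))
    (algebraMap (A2 α) (overlapRing α β))
  have h2 := globalHom_comp_specMap (𝟙 (overlapScheme α β)) (transition α β)
  rw [Category.id_comp, show Spec.map _ = m ≫ p from hp.symm, globalHom_comp] at h1
  rw [Category.id_comp, show Spec.map _ = m ≫ q from hq.symm, globalHom_comp] at h2
  refine ⟨globalHom p x * globalHom q y, ?_⟩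
  rw [map_mul, map_mul]
  exact congrArg₂ (· * ·) (congrArg (fun φ => φ x) h1) (congrArg (fun φ => φ y) h2)

open Limits in
/-- Over the product of two charts, the diagonal of a gluing is the embedding of the overlap. -/
lemma isClosedImmersion_diagonal_snd {Y : Scheme.{u}} (f : Y ⟶ SpecF2.{u})
    {k : chartScheme α ⟶ Y} {l : chartScheme β ⟶ Y}
    (h : IsPullback (overlapι α β) (overlapTr α β) k l) :
    IsClosedImmersion (pullback.snd (pullback.diagonal f)
      (pullback.map (k ≫ f) (l ≫ f) f f k l (𝟙 _) (Category.comp_id _) (Category.comp_id _))) := by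
  have sq := pullback_map_diagonal_isPullback k l f
  let m' : pullback k l ⟶ pullback (k ≫ f) (l ≫ f) :=
    pullback.map k l (k ≫ f) (l ≫ f) (𝟙 _) (𝟙 _) f
      (Category.id_comp _).symm (Category.id_comp _).symm
  have hm : IsClosedImmersion (h.isoPullback.hom ≫ m') :=
    isClosedImmersion_of_overlap (α := α) (β := β)
      (p := pullback.fst _ _) (q := pullback.snd _ _) _
      (by
        rw [Category.assoc, pullback.lift_fst, Category.comp_id]
        exact h.isoPullback_hom_fst)
      (by
        rw [Category.assoc, pullback.lift_snd, Category.comp_id]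
        exact h.isoPullback_hom_snd)
  rw [MorphismProperty.cancel_left_of_respectsIso (P := @IsClosedImmersion)] at hm
  change IsClosedImmersion (pullback.map _ _ _ _ _ _ _ _ _) at hm
  rw [← sq.isoPullback_hom_snd,
    MorphismProperty.cancel_left_of_respectsIso (P := @IsClosedImmersion)] at hm
  exact hm

end Separated

namespace IsGluing

open Limits

variable {Ch : Over SpecF2.{u}} {ι : ∀ α : G, chart α ⟶ Ch} (H : IsGluing Ch ι)

/-- The open cover of a gluing by the charts. -/
noncomputable def openCover : Ch.left.OpenCover :=
  Scheme.Cover.mkOfCovers G (fun α => (chart α).left) (fun α => (ι α).left) H.cover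
    H.isOpenImmersion

include H

/-- The diagonal is a closed immersion over each product of two charts. -/
lemma isSeparated : IsSeparated Ch.hom := by
  refine ⟨IsZariskiLocalAtTarget.of_openCover (P := @IsClosedImmersion)
    (Scheme.Pullback.openCoverOfLeftRight H.openCover H.openCover Ch.hom Ch.hom) ?_⟩
  rintro ⟨α, β⟩
  exact isClosedImmersion_diagonal_snd Ch.hom (H.overlap α β)

end IsGluing

/-! ### Finiteness -/

section Finite

variable {s : Set G}

/-- The values of the universal `a_α`, `b_α` at generators of the monoid, together with `d(α)`,
generate the coordinate ring: the product rules reach all values of `a_α` and `b_α`, and the norm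
relation then gives those of `d`. -/
lemma finiteType_A2 (hs : Submonoid.closure s = ⊤) (hf : s.Finite) (α : G) :
    (algebraMap F2.{u} (A2 α)).FiniteType := by
  let c := univCoeff α
  let T : Set (A2 α) := c.a '' s ∪ c.b '' s ∪ {c.d α}
  let S : Subalgebra F2.{u} (A2 α) := Algebra.adjoin F2.{u} T
  have hT : T.Finite := ((hf.image _).union (hf.image _)).union (Set.finite_singleton _)
  have hdα : c.d α ∈ S := Algebra.subset_adjoin (Or.inr rfl)
  have hab : ∀ g, c.a g ∈ S ∧ c.b g ∈ S := by
    intro g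
    have hg : g ∈ Submonoid.closure s := hs ▸ Submonoid.mem_top g
    induction hg using Submonoid.closure_induction with
    | mem g hg =>
      exact ⟨Algebra.subset_adjoin (Or.inl (Or.inl ⟨g, hg, rfl⟩)),
        Algebra.subset_adjoin (Or.inl (Or.inr ⟨g, hg, rfl⟩))⟩
    | one => rw [c.a_one, c.b_one]; exact ⟨one_mem _, zero_mem _⟩
    | mul g h _ _ hg hh =>
      rw [c.a_mul, c.b_mul]
      exact ⟨add_mem (mul_mem hg.1 hh.1) (mul_mem (mul_mem hg.2 hh.2) hdα),
        add_mem (mul_mem hg.1 hh.2) (mul_mem hg.2 hh.1)⟩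
  have hd : ∀ g, c.d g ∈ S := by
    intro g
    rw [← c.norm g]
    exact add_mem (pow_mem (hab g).1 2) (mul_mem (pow_mem (hab g).2 2) hdα)
  have hF : ∀ φ : F2.{u} →+* A2 α, ∀ x, φ x ∈ S := fun φ x => by
    rw [F2.subsingleton_ringHom.elim φ (algebraMap F2.{u} (A2 α))]
    exact Subalgebra.algebraMap_mem _ _
  have h1 : ∀ x : A1 G, algebraMap (A1 G) (A2 α) x ∈ S := by
    intro x
    obtain ⟨p, rfl⟩ : ∃ p, A1.mk G p = x := Ideal.Quotient.mk_surjective x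
    induction p using MvPolynomial.induction_on with
    | C r => exact hF (((algebraMap (A1 G) (A2 α)).comp (A1.mk G)).comp MvPolynomial.C) r
    | add p q hp hq => rw [map_add, map_add]; exact add_mem hp hq
    | mul_X p g hp => rw [map_mul, map_mul]; exact mul_mem hp (hd g)
  have htop : S = ⊤ := by
    refine eq_top_iff.2 fun x _ => ?_
    obtain ⟨p, rfl⟩ : ∃ p, A2.mk α p = x := Ideal.Quotient.mk_surjective x
    induction p using MvPolynomial.induction_on with
    | C r => exact h1 r
    | add p q hp hq => rw [map_add]; exact add_mem (hp trivial) (hq trivial)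
    | mul_X p g hp =>
      rw [map_mul]
      refine mul_mem (hp trivial) ?_
      rcases g with g | g
      · exact (hab g).1
      · exact (hab g).2
  rw [RingHom.finiteType_algebraMap]
  exact ⟨hT.toFinset, by rw [Set.Finite.coe_toFinset]; exact htop⟩

/-- Each point of a chart lies in one of the charts of the elements of a generating set. -/
lemma exists_mem_range_overlapι (hs : Submonoid.closure s = ⊤) {α : G} (y : chartScheme α) :
    ∃ g ∈ s, y ∈ Set.range (overlapι α g) := by
  let y' : PrimeSpectrum (A2 α) := y
  obtain ⟨g, hg, hb⟩ := ((univCoeff α).map (Ideal.Quotient.mk y'.asIdeal)).exists_b_ne_zero hs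
  refine ⟨g, hg, ?_⟩
  have : y' ∈ Set.range (PrimeSpectrum.comap (algebraMap (A2 α) (overlapRing α g))) := by
    rw [PrimeSpectrum.localization_away_comap_range _ ((univCoeff α).b g)]
    exact fun h => hb (Ideal.Quotient.eq_zero_iff_mem.2 h)
  exact this

end Finite

namespace IsGluing

variable {Ch : Over SpecF2.{u}} {ι : ∀ α : G, chart α ⟶ Ch} (H : IsGluing Ch ι)

include H

lemma locallyOfFiniteType [Monoid.FG G] : LocallyOfFiniteType Ch.hom := by
  obtain ⟨s, hs, hf⟩ := Monoid.fg_iff.1 ‹Monoid.FG G›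
  have (α : H.openCover.I₀) : IsAffine (H.openCover.X α) :=
    inferInstanceAs (IsAffine (chartScheme (G := G) α))
  refine HasRingHomProperty.of_source_openCover (P := @LocallyOfFiniteType) H.openCover
    fun (α : G) => ?_
  change ((ι α).left ≫ Ch.hom).appTop.hom.FiniteType
  have hα : LocallyOfFiniteType (chart α).hom :=
    (HasRingHomProperty.Spec_iff (P := @LocallyOfFiniteType)).2 (finiteType_A2 hs hf α)
  have : IsAffine (chart α).left := inferInstanceAs (IsAffine (chartScheme α))
  rw [Over.w]
  exact HasRingHomProperty.appTop (P := @LocallyOfFiniteType) _ hα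

/-- The charts of the elements of a finite generating set cover the gluing. -/
lemma quasiCompact [Monoid.FG G] : QuasiCompact Ch.hom := by
  obtain ⟨s, hs, hf⟩ := Monoid.fg_iff.1 ‹Monoid.FG G›
  suffices CompactSpace Ch.left from inferInstance
  refine ⟨?_⟩
  have : (Set.univ : Set Ch.left) = ⋃ g ∈ s, Set.range (ι g).left := by
    refine (Set.eq_univ_of_forall fun x => ?_).symm
    obtain ⟨α, y, rfl⟩ := H.cover x
    obtain ⟨g, hg, z, rfl⟩ := exists_mem_range_overlapι hs y
    refine Set.mem_biUnion hg ⟨overlapTr α g z, ?_⟩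
    exact congrArg (fun φ => φ z) (H.overlap α g).w.symm
  rw [this]
  refine hf.isCompact_biUnion fun g _ => ?_
  have : CompactSpace (chart g).left := inferInstanceAs (CompactSpace (chartScheme g))
  exact isCompact_range (ι g).left.continuous

end IsGluing

end UnipotentModuli

theorem mainTheorem3 (G : Type u) [Monoid G] :
    ∃ (Ch : Over UnipotentModuli.SpecF2.{u}) (ι : ∀ α : G, UnipotentModuli.chart α ⟶ Ch),
      -- the charts parametrize `(a, b)`-coefficients
      (∀ (α : G) (X : Over UnipotentModuli.SpecF2.{u}),
        Function.Bijective (UnipotentModuli.coeffOf (α := α) (X := X))) ∧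
      -- `Ch` is obtained by gluing the charts
      UnipotentModuli.IsGluing Ch ι ∧
      -- `Ch` represents the sheafified functor, through `(a, b)`-coefficients
      (∃ r : (UnipotentModuli.eqU2F2 G).RepresentableBy Ch,
        ∀ (X : Over UnipotentModuli.SpecF2.{u}) (ρ : UnipotentModuli.Rep G X.left)
          (hρ : ρ.IsUnipotentF2) (α : G) (f : X ⟶ UnipotentModuli.chart α),
          (UnipotentModuli.coeffOf f).IsOf ρ →
            r.homEquiv (f ≫ ι α) = UnipotentModuli.eqU2F2.mk ρ hρ) ∧
      -- separated, and of finite type if `G` is finitely generated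
      IsSeparated Ch.hom ∧
      (Monoid.FG G → LocallyOfFiniteType Ch.hom ∧ QuasiCompact Ch.hom) := by
  have H := UnipotentModuli.isGluing_moduli G
  exact ⟨UnipotentModuli.moduli G, UnipotentModuli.moduliι, UnipotentModuli.coeffOf_bijective, H,
    H.exists_representableBy, H.isSeparated, fun _ => ⟨H.locallyOfFiniteType, H.quasiCompact⟩⟩
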